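/- Let $\Gamma$ be a Lie group and $1\to\mathbb T\to\widehat\Gamma\xrightarrow{q}\Gamma\to1$ a central extension of Lie groups by the circle, for which $q:\widehat\Gamma\to\Gamma$ is a principal $\mathbb T$-bundle; identify $\mathrm{Lie}\,\mathbb T=\mathrm i\mathbb R$ with its image in the centre of $\mathrm{Lie}\,\widehat\Gamma$. Let $\pi:B\to X$ be a principal $\Gamma$-bundle with a connection $\theta$ and a splitting $L$, i.e. a vector bundle map $L:B\times_{\mathrm{Ad}}\mathrm{Lie}\,\widehat\Gamma\to B\times_{\mathrm{Ad}}\mathrm i\mathbb R=X\times\mathrm i\mathbb R$ which is the identity on $B\times_{\mathrm{Ad}}\mathrm i\mathbb R$; write $L([b,\hat Y])=[b,\overline L(b,\hat Y)]$. Let $\sigma:\mathrm{Lie}\,\Gamma\to\mathrm{Lie}\,\widehat\Gamma$ be a linear map with $q_*\circ\sigma=\mathrm{id}$ (continuous, if the groups are infinite dimensional). Put $\omega_\sigma(Y,Z)=[\sigma Y,\sigma Z]-\sigma[Y,Z]$ and $Z_\sigma(\gamma,Y)=\mathrm{Ad}_\gamma\sigma(Y)-\sigma(\mathrm{Ad}_\gamma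 Y)$ for $\gamma\in\Gamma$ and $Y,Z\in\mathrm{Lie}\,\Gamma$; here $\Gamma$ acts on $\mathrm{Lie}\,\widehat\Gamma$ through the adjoint action of lifts to $\widehat\Gamma$. Let $F_\theta=d\theta+\frac12[\theta,\theta]$, and let $$f_{\theta,\sigma}=-\tfrac12\,\omega_\sigma(\theta,\theta)-\kappa_{\theta,\sigma}\in \mathrm i\Omega^2(B),\qquad \kappa_{\theta,\sigma}(b;V,W)=\overline L\bigl(b,\sigma(F_\theta(b;V,W))\bigr).$$ Let $\zeta:B^{[2]}=B\times_XB\to\Gamma$ be defined by $b_1\zeta(b_1,b_2)=b_2$, let $\pi_i:B^{[2]}\to B$ be the projection to the $i$-th factor, and let $\rho:J_B=\zeta^*\widehat\Gamma\to B^{[2]}$ be the $\mathbb T$-bundle of the lifting bundle gerbe. It carries the connection $\nabla_{\theta,\sigma}=\zeta^*\nu_\sigma+\rho^*Z_\sigma(\zeta^{-1},\pi_1^*\theta)$, where $\nu_\sigma=\hat\mu-\sigma(q^*\mu)$ and $\hat\mu,\mu$ are the Maurer–Cartan forms of $\widehat\Gamma,\Gamma$. A $2$-form $f\in\mathrm i\Omega^2(B)$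 is a curving for $\nabla_{\theta,\sigma}$ if the curvature of $\nabla_{\theta,\sigma}$ is $-\pi_1^*f+\pi_2^*f$, and the $3$-curvature of $(J_B,\nabla_{\theta,\sigma},f)$ is then the form $\Xi\in\mathrm i\Omega^3(X)$ with $df=\pi^*\Xi$. Suppose that $B$ admits a lifting $(\widehat B,\hat q)$, i.e. a principal $\widehat\Gamma$-bundle $\hat\pi:\widehat B\to X$ with a smooth map $\hat q:\widehat B\to B$ over $X$ such that $\hat q(\hat b\hat\gamma)=\hat q(\hat b)\,q(\hat\gamma)$, and that $\hat\theta$ is a connection on $\widehat B$ compatible with $\theta$, i.e. $q_*\hat\theta=\hat q^*\theta$. Let $K_{\hat\theta}=L\circ F_{\hat\theta}\in\mathrm i\Omega^2(X)$ be the scalar curvature of $\hat\theta$, where the curvature $F_{\hat\theta}$ is regarded as a $2$-form on $X$ with values in $\widehat B\times_{\mathrm{Ad}}\mathrm{Lie}\,\widehat\Gamma\cong B\times_{\mathrm{Ad}}\mathrm{Lie}\,\widehat\Gamma$; that is, $K_{\hat\theta}$ is the unique smooth $2$-form on $X$ with $(\hat\pi^*K_{\hat\theta})(\hat b;V,W)=\overline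 L(\hat q(\hat b),F_{\hat\theta}(\hat b;V,W))$. Then $N=\hat\theta-\sigma(\hat q^*\theta)$ takes values in $\mathrm i\mathbb R$ and is a connection on the principal $\mathbb T$-bundle $\hat q:\widehat B\to B$; its curvature descends to a unique smooth form $F_N\in\mathrm i\Omega^2(B)$, and $$f_{\theta,\sigma}=F_N-\pi^*K_{\hat\theta}.$$ Moreover $f_{\theta,\sigma}$ is a curving for $\nabla_{\theta,\sigma}$, and the $3$-curvature of $(J_B,\nabla_{\theta,\sigma},f_{\theta,\sigma})$ is $$\Xi=-\,dK_{\hat\theta}.$$ -/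

import Mathlib

open scoped Manifold ContDiff Topology

namespace LiftingProblem

/-! ## Differential forms on manifolds -/

section Forms

variable {E : Type*} [NormedAddCommGroup E] [NormedSpace ℝ E]
  {H : Type*} [TopologicalSpace H] (I : ModelWithCorners ℝ E H)
  {M : Type*} [TopologicalSpace M] [ChartedSpace H M]
  {E' : Type*} [NormedAddCommGroup E'] [NormedSpace ℝ E']
  {H' : Type*} [TopologicalSpace H'] (I' : ModelWithCorners ℝ E' H')
  {M' : Type*} [TopologicalSpace M'] [ChartedSpace H' M']
  {F : Type*} [NormedAddCommGroup F] [NormedSpace ℝ F]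
  {F' : Type*} [NormedAddCommGroup F'] [NormedSpace ℝ F']
  {F'' : Type*} [NormedAddCommGroup F''] [NormedSpace ℝ F'']
  {k : ℕ}

/-- A (not necessarily smooth) `k`-form on a manifold `M` modelled on `E`, with values in `F`:
a continuous alternating `k`-linear map on each tangent space. The tangent space
`TangentSpace I x` is by definition a copy of `E` (`E` is identified with `T_x M` through the
preferred chart at `x`), and the norm of `E` gives the topology of the space of such maps. -/
abbrev DForm (E : Type*) [NormedAddCommGroup E] [NormedSpace ℝ E] (M : Type*) (k : ℕ)
    (F : Type*) [NormedAddCommGroup F] [NormedSpace ℝ F] : Type _ :=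
  M → E [⋀^Fin k]→L[ℝ] F

/-- The pull-back `f^* η`. -/
noncomputable def pullback (f : M → M') (η : DForm E' M' k F) : DForm E M k F := fun x =>
  (η (f x)).compContinuousLinearMap (mfderiv I I' f x : E →L[ℝ] E')

/-- The form `A ∘ η` obtained by applying a continuous linear map to the values of `ω`. -/
noncomputable def mapForm (A : F →L[ℝ] F') (η : DForm E M k F) : DForm E M k F' := fun x =>
  A.compContinuousAlternatingMap (η x)

/-- The expression of a form in the preferred chart around `x₀`, a form on the model space. -/
noncomputable def formInChart (x₀ : M) (η : DForm E M k F) : E → E [⋀^Fin k]→L[ℝ] F := fun y =>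
  (η ((extChartAt I x₀).symm y)).compContinuousLinearMap
    (mfderivWithin 𝓘(ℝ, E) I (extChartAt I x₀).symm (Set.range I) y : E →L[ℝ] E)

/-- A form is smooth when its expression in every preferred chart is smooth. -/
def IsSmoothForm (η : DForm E M k F) : Prop :=
  ∀ x₀ : M, ContDiffOn ℝ ∞ (formInChart I x₀ η) (extChartAt I x₀).target

/-- The exterior derivative: `dη` at `x` is computed in the preferred chart around `x`. -/
noncomputable def dForm (η : DForm E M k F) : DForm E M (k + 1) F := fun x =>
  (extDerivWithin (formInChart I x η) (Set.range I) (extChartAt I x x)).compContinuousLinearMap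
    (mfderiv I 𝓘(ℝ, E) (extChartAt I x) x : E →L[ℝ] E)

/-- A `1`-form at a point, as a linear map. -/
noncomputable def oneForm (α : E [⋀^Fin 1]→L[ℝ] F) : E →L[ℝ] F :=
  (ContinuousAlternatingMap.ofSubsingleton ℝ E F (0 : Fin 1)).symm α

/-- The `2`-form `c(α, β)` obtained from two `1`-forms and a bilinear map `c`:
`c(α, β)(V, W) = c (α V) (β W) - c (α W) (β V)`. -/
noncomputable def wedge (c : F →L[ℝ] F' →L[ℝ] F'') (α : DForm E M 1 F) (β : DForm E M 1 F') :
    DForm E M 2 F'' := fun x =>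
  ContinuousAlternatingMap.alternatizeUncurryFin
    ((ContinuousAlternatingMap.ofSubsingletonLIE (𝕜 := ℝ) (E := E) (F := F'') (0 : Fin 1)
        ).toContinuousLinearEquiv.toContinuousLinearMap ∘L
      (c.bilinearComp (oneForm (α x)) (oneForm (β x))))

theorem oneForm_apply (α : E [⋀^Fin 1]→L[ℝ] F) (v : E) : oneForm α v = α ![v] := by
  simp only [oneForm]
  conv_rhs => rw [← (ContinuousAlternatingMap.ofSubsingleton ℝ E F (0 : Fin 1)).apply_symm_apply α]
  rfl

theorem wedge_apply {M : Type*} (c : F →L[ℝ] F' →L[ℝ] F'') (α : DForm E M 1 F) (β : DForm E M 1 F')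
    (x : M) (v w : E) :
    wedge c α β x ![v, w] = c (α x ![v]) (β x ![w]) - c (α x ![w]) (β x ![v]) := by
  simp [wedge, ContinuousAlternatingMap.alternatizeUncurryFin_apply, Fin.sum_univ_two, oneForm_apply, sub_eq_add_neg, Fin.removeNth]

end Forms

/-! ## The Lie algebra of a Lie group -/

section LieGroups

variable {E : Type*} [NormedAddCommGroup E] [NormedSpace ℝ E] [CompleteSpace E]
  {G : Type*} [TopologicalSpace G] [ChartedSpace E G] [Group G] [LieGroup 𝓘(ℝ, E) ∞ G]

open VectorField Set

theorem lieGroup_minSmoothness {E : Type*} [NormedAddCommGroup E] [NormedSpace ℝ E]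
  {G : Type*} [TopologicalSpace G] [ChartedSpace E G] [Group G] [LieGroup 𝓘(ℝ, E) ∞ G] : LieGroup 𝓘(ℝ, E) (minSmoothness ℝ 3) G :=
  LieGroup.of_le (n := ∞) (by rw [minSmoothness_of_isRCLikeNormedField]; exact WithTop.coe_le_coe.2 le_top)

theorem exists_lieAd (v : GroupLieAlgebra 𝓘(ℝ, E) G) :
    ∃ A : E →L[ℝ] E, ∀ w : GroupLieAlgebra 𝓘(ℝ, E) G, A w = ⁅v, w⁆ := by
  have : LieGroup 𝓘(ℝ, E) (minSmoothness ℝ 3) G := lieGroup_minSmoothness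
  have : IsManifold 𝓘(ℝ, E) 2 G := IsManifold.of_le (n := ∞) (WithTop.coe_le_coe.2 le_top)
  let φ := extChartAt 𝓘(ℝ, E) (1 : G)
  let C : E → E →L[ℝ] E := fun y =>
    ((mfderivWithin 𝓘(ℝ, E) 𝓘(ℝ, E) φ.symm (range 𝓘(ℝ, E)) y).inverse : E →L[ℝ] E) ∘L
      (mfderiv 𝓘(ℝ, E) 𝓘(ℝ, E) (fun h : G => φ.symm y * h) 1 : E →L[ℝ] E)
  let y0 : E := φ 1
  have hs : φ.symm ⁻¹' univ ∩ range 𝓘(ℝ, E) = univ := by simp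
  have hd : ∀ w : E, DifferentiableAt ℝ (fun y => C y w) y0 := by
    intro w
    have h := (mdifferentiableAt_mulInvariantVectorField (I := 𝓘(ℝ, E)) (G := G) w
      (g := 1)).mdifferentiableWithinAt (s := univ)
    have h2 := MDifferentiableWithinAt.differentiableWithinAt_mpullbackWithin_vectorField h
    rw [hs] at h2
    exact differentiableWithinAt_univ.1 h2
  have hlim : ∀ u : E, ∃ D : E →L[ℝ] E, ∀ w, D w = fderiv ℝ (fun y => C y w) y0 u := by
    intro u
    let g : ℝ → E →L[ℝ] E := fun c => c • (C (y0 + c⁻¹ • u) - C y0)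
    have hg : Filter.Tendsto (fun n w => g n w) Filter.atTop
        (𝓝 (fun w => fderiv ℝ (fun y => C y w) y0 u)) := by
      rw [tendsto_pi_nhds]
      intro w
      exact (hd w).hasFDerivAt.lim_real u
    exact ⟨continuousLinearMapOfTendsto g hg, fun w => rfl⟩
  obtain ⟨D, hD⟩ := hlim (C y0 v)
  refine ⟨((mfderiv 𝓘(ℝ, E) 𝓘(ℝ, E) φ (1 : G)).inverse : E →L[ℝ] E) ∘L
    (D - (fderiv ℝ (fun y => C y v) y0) ∘L C y0), fun w => ?_⟩
  have key : (⁅v, w⁆ : GroupLieAlgebra 𝓘(ℝ, E) G) =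
      ((mfderiv 𝓘(ℝ, E) 𝓘(ℝ, E) φ (1 : G)).inverse : E →L[ℝ] E)
        (fderiv ℝ (fun y => C y w) y0 (C y0 v) - fderiv ℝ (fun y => C y v) y0 (C y0 w)) := by
    rw [GroupLieAlgebra.bracket_def, ← mlieBracketWithin_univ, mlieBracketWithin_apply]
    rw [hs]
    exact congrArg (fun F : E → E =>
      ((mfderiv 𝓘(ℝ, E) 𝓘(ℝ, E) φ (1 : G)).inverse : E →L[ℝ] E) (F y0))
      (lieBracketWithin_univ (𝕜 := ℝ) (V := fun y => C y v) (W := fun y => C y w))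
  rw [key, ← hD w]
  rfl

theorem exists_lieBracketCLM :
    ∃ c : E →L[ℝ] E →L[ℝ] E, ∀ v w : GroupLieAlgebra 𝓘(ℝ, E) G, c v w = ⁅v, w⁆ := by
  have : LieGroup 𝓘(ℝ, E) (minSmoothness ℝ 3) G := lieGroup_minSmoothness
  choose A hA using fun v => exists_lieAd (E := E) (G := G) v
  let T : E →ₗ[ℝ] E →L[ℝ] E :=
    { toFun := A
      map_add' := fun x y => by
        ext w
        exact (hA _ w).trans ((add_lie (L := GroupLieAlgebra 𝓘(ℝ, E) G)
          (M := GroupLieAlgebra 𝓘(ℝ, E) G) x y w).trans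
            (congrArg₂ (fun a b : E => a + b) (hA x w).symm (hA y w).symm))
      map_smul' := fun r x => by
        ext w
        exact (hA _ w).trans ((smul_lie (L := GroupLieAlgebra 𝓘(ℝ, E) G)
          (M := GroupLieAlgebra 𝓘(ℝ, E) G) r x w).trans
            (congrArg (fun a : E => r • a) (hA x w).symm)) }
  have hT : Continuous T := by
    refine T.continuous_of_seq_closed_graph fun u x y hu hy => ?_
    ext w
    have h1 : Filter.Tendsto (fun n => A (u n) w) Filter.atTop (𝓝 (y w)) :=
      ((ContinuousLinearMap.apply ℝ E w).continuous.tendsto y).comp hy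
    have e : ∀ z : E, A z w = -A w z := fun z => (hA z w).trans
      ((lie_skew (L := GroupLieAlgebra 𝓘(ℝ, E) G) z w).symm.trans
        (congrArg (fun a : E => -a) (hA w z).symm))
    have h2 : Filter.Tendsto (fun n => A (u n) w) Filter.atTop (𝓝 (A x w)) := by
      simp only [e]
      exact (((A w).continuous.tendsto x).comp hu).neg
    exact tendsto_nhds_unique h1 h2
  exact ⟨⟨T, hT⟩, fun v w => hA v w⟩

variable (E G) in
/-- The Lie bracket of the Lie algebra `GroupLieAlgebra 𝓘(ℝ, E) G = T_1 G` of a Lie group (a copy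
of the model space `E`), as a continuous bilinear map. -/
noncomputable def lieBracketCLM : E →L[ℝ] E →L[ℝ] E :=
  Classical.choose (exists_lieBracketCLM (E := E) (G := G))

theorem lieBracketCLM_apply (v w : GroupLieAlgebra 𝓘(ℝ, E) G) :
    lieBracketCLM E G v w = ⁅v, w⁆ :=
  Classical.choose_spec (exists_lieBracketCLM (E := E) (G := G)) v w

end LieGroups

section LieGroups

variable {E : Type*} [NormedAddCommGroup E] [NormedSpace ℝ E]
  {G : Type*} [TopologicalSpace G] [ChartedSpace E G] [Group G]
  {E' : Type*} [NormedAddCommGroup E'] [NormedSpace ℝ E']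
  {G' : Type*} [TopologicalSpace G'] [ChartedSpace E' G'] [Group G']

/-- The homomorphism `f_* : Lie G → Lie G'` induced by a homomorphism of Lie groups. -/
noncomputable def lieMap (f : G →* G') : E →L[ℝ] E' := mfderiv 𝓘(ℝ, E) 𝓘(ℝ, E') f 1

/-- The adjoint action of `g` on `Lie G`. -/
noncomputable def Ad (g : G) : E →L[ℝ] E :=
  mfderiv 𝓘(ℝ, E) 𝓘(ℝ, E) (fun h : G => g * h * g⁻¹) 1

variable (E G) in
/-- The (left) Maurer-Cartan form, the `Lie G`-valued `1`-form given at `g` by the differential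
of `h ↦ g⁻¹ h`. -/
noncomputable def maurerCartan : DForm E G 1 E := fun g =>
  ContinuousAlternatingMap.ofSubsingleton ℝ E E (0 : Fin 1)
    (mfderiv 𝓘(ℝ, E) 𝓘(ℝ, E) (fun h : G => g⁻¹ * h) g : E →L[ℝ] E)

end LieGroups

/-! ## Principal bundles, connections and curvature -/

section PrincipalBundles

variable {EX : Type*} [NormedAddCommGroup EX] [NormedSpace ℝ EX]
  {X : Type*} [TopologicalSpace X] [ChartedSpace EX X]
  {EP : Type*} [NormedAddCommGroup EP] [NormedSpace ℝ EP]
  {P : Type*} [TopologicalSpace P] [ChartedSpace EP P]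
  {E : Type*} [NormedAddCommGroup E] [NormedSpace ℝ E]
  {G : Type*} [TopologicalSpace G] [ChartedSpace E G] [Group G]

/-- `π : P → X`, with the map `act : P → G → P`, `(p, g) ↦ p g`, is a smooth principal
`G`-bundle. -/
structure IsPrincipalBundle (π : P → X) (act : P → G → P) : Prop where
  smooth_proj : ContMDiff 𝓘(ℝ, EP) 𝓘(ℝ, EX) ∞ π
  smooth_act : ContMDiff (𝓘(ℝ, EP).prod 𝓘(ℝ, E)) 𝓘(ℝ, EP) ∞ (fun p : P × G => act p.1 p.2)
  act_one : ∀ p, act p 1 = p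
  act_mul : ∀ p g h, act p (g * h) = act (act p g) h
  proj_act : ∀ p g, π (act p g) = π p
  locally_trivial : ∀ x : X, ∃ e : Bundle.Trivialization G π, x ∈ e.baseSet ∧
    ContMDiffOn 𝓘(ℝ, EP) (𝓘(ℝ, EX).prod 𝓘(ℝ, E)) ∞ e e.source ∧
    ContMDiffOn (𝓘(ℝ, EX).prod 𝓘(ℝ, E)) 𝓘(ℝ, EP) ∞ e.toOpenPartialHomeomorph.symm e.target ∧
    ∀ p ∈ e.source, ∀ g, (e (act p g)).2 = (e p).2 * g

/-- The value at `p` of the fundamental vector field generated by `Y ∈ Lie G`. -/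
noncomputable def fundamentalVector (act : P → G → P) (Y : E) (p : P) : EP :=
  (mfderiv 𝓘(ℝ, E) 𝓘(ℝ, EP) (act p) 1 : E →L[ℝ] EP) Y

/-- `θ` is a connection (form) on a principal `G`-bundle with total space `P`: a smooth
`Lie G`-valued `1`-form which reproduces the generators of fundamental vector fields and satisfies
`R_g^* θ = Ad_{g⁻¹} θ`. -/
structure IsConnection (act : P → G → P) (θ : DForm EP P 1 E) : Prop where
  smooth : IsSmoothForm 𝓘(ℝ, EP) θ
  fundamental : ∀ p Y, θ p ![fundamentalVector act Y p] = Y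
  equivariant : ∀ g, pullback 𝓘(ℝ, EP) 𝓘(ℝ, EP) (fun p => act p g) θ = mapForm (Ad g⁻¹) θ

end PrincipalBundles

section Curvature

variable {E : Type*} [NormedAddCommGroup E] [NormedSpace ℝ E] [CompleteSpace E]
  {EP : Type*} [NormedAddCommGroup EP] [NormedSpace ℝ EP]
  {H : Type*} [TopologicalSpace H] (I : ModelWithCorners ℝ EP H)
  {P : Type*} [TopologicalSpace P] [ChartedSpace H P]

/-- The curvature `F_θ = dθ + ½ [θ, θ]` of a `Lie G`-valued `1`-form. -/
noncomputable def curvature (G : Type*) [TopologicalSpace G] [ChartedSpace E G] [Group G]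
    [LieGroup 𝓘(ℝ, E) ∞ G] (θ : DForm EP P 1 E) : DForm EP P 2 E :=
  dForm I θ + (1 / 2 : ℝ) • wedge (lieBracketCLM E G) θ θ

end Curvature

/-! ## Central extensions by the circle and liftings -/

/-- The Lie algebra `iℝ` of the circle group `𝕋`: the tangent space `T_1 𝕋` of Mathlib's Lie group
`Circle`, which is a copy of the model space of `Circle`. -/
abbrev LieT : Type := EuclideanSpace ℝ (Fin 1)

section CentralExtensions

variable {E : Type*} [NormedAddCommGroup E] [NormedSpace ℝ E] [CompleteSpace E]
  {G : Type*} [TopologicalSpace G] [ChartedSpace E G] [Group G] [LieGroup 𝓘(ℝ, E) ∞ G]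
  {E' : Type*} [NormedAddCommGroup E'] [NormedSpace ℝ E'] [CompleteSpace E']
  {G' : Type*} [TopologicalSpace G'] [ChartedSpace E' G'] [Group G'] [LieGroup 𝓘(ℝ, E') ∞ G']

/-- `1 → 𝕋 → G' → G → 1` (with maps `ι` and `q`) is a central extension of Lie groups; in
particular `q : G' → G` is a principal `𝕋`-bundle. -/
structure IsCentralExtension (ι : Circle →* G') (q : G' →* G) : Prop where
  smooth_incl : ContMDiff (𝓡 1) 𝓘(ℝ, E') ∞ ι
  smooth_proj : ContMDiff 𝓘(ℝ, E') 𝓘(ℝ, E) ∞ q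
  injective : Function.Injective ι
  surjective : Function.Surjective q
  exact : q.ker = ι.range
  central : ι.range ≤ Subgroup.center G'
  bundle : IsPrincipalBundle (EX := E) (EP := E') (E := LieT) q (fun (g : G') (u : Circle) => g * ι u)

/-- A split `σ` of `0 → iℝ → Lie G' → Lie G → 0` as (topological) vector spaces. -/
def IsSplit (q : G' →* G) (σ : E →L[ℝ] E') : Prop := ∀ Y : E, lieMap q (σ Y) = Y

open Classical in
/-- The identification of the central line `ι_* (iℝ)` of `Lie G'` with `iℝ`: the inverse of `ι_*`,
extended to a continuous linear map on `Lie G'`. It is only applied to elements of that line. -/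
noncomputable def centralCoord (ι : Circle →* G') : E' →L[ℝ] LieT :=
  if h : (lieMap (E := LieT) (E' := E') ι).HasLeftInverse then h.leftInverse else 0

theorem centralCoord_lieMap (ι : Circle →* G')
    (h : Function.Injective (lieMap (E := LieT) (E' := E') ι)) (z : LieT) :
    centralCoord ι (lieMap (E := LieT) (E' := E') ι z) = z := by
  have hl : (lieMap (E := LieT) (E' := E') ι).HasLeftInverse := by
    apply ContinuousLinearMap.HasLeftInverse.of_injective_of_isClosed_range_of_closedComplement_range h
    · exact (lieMap (E := LieT) (E' := E') ι).range.closed_of_finiteDimensional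
    · exact Submodule.ClosedComplemented.of_finiteDimensional _
  rw [centralCoord, dif_pos hl]
  exact hl.leftInverse_leftInverse z

/-- The Lie algebra cocycle `ω_σ(Y, Z) = [σ Y, σ Z] - σ [Y, Z]`. -/
noncomputable def lieCocycle (G : Type*) [TopologicalSpace G] [ChartedSpace E G] [Group G]
    [LieGroup 𝓘(ℝ, E) ∞ G] (ι : Circle →* G') (σ : E →L[ℝ] E') : E →L[ℝ] E →L[ℝ] LieT :=
  (ContinuousLinearMap.compL ℝ E E' LieT (centralCoord ι)) ∘L
    ((lieBracketCLM E' G').bilinearComp σ σ -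
      (ContinuousLinearMap.compL ℝ E E E' σ) ∘L lieBracketCLM E G)

/-- The group cocycle `Z_σ(q γ, Y) = Ad_γ (σ Y) - σ (Ad_{q γ} Y)`, as a function of
`γ ∈ G'`; it depends on `q γ` only, because the centre of `G'` acts trivially on `Lie G'`. -/
noncomputable def groupCocycle (ι : Circle →* G') (q : G' →* G) (σ : E →L[ℝ] E') (γ : G') :
    E →L[ℝ] LieT :=
  centralCoord ι ∘L (Ad γ ∘L σ - σ ∘L Ad (q γ))

/-- The connection `ν_σ = μ' - σ (q^* μ)` on the `𝕋`-bundle `q : G' → G`, where `μ'`, `μ` are the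
Maurer-Cartan forms of `G'` and `G`. -/
noncomputable def extensionConnection (ι : Circle →* G') (q : G' →* G) (σ : E →L[ℝ] E') :
    DForm E' G' 1 LieT :=
  mapForm (centralCoord ι) (maurerCartan E' G' -
    mapForm σ (pullback 𝓘(ℝ, E') 𝓘(ℝ, E) q (maurerCartan E G)))

variable {EX : Type*} [NormedAddCommGroup EX] [NormedSpace ℝ EX]
  {X : Type*} [TopologicalSpace X] [ChartedSpace EX X]
  {EB : Type*} [NormedAddCommGroup EB] [NormedSpace ℝ EB]
  {B : Type*} [TopologicalSpace B] [ChartedSpace EB B]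
  {EB' : Type*} [NormedAddCommGroup EB'] [NormedSpace ℝ EB']
  {B' : Type*} [TopologicalSpace B'] [ChartedSpace EB' B']

/-- A splitting of the `G`-bundle `B`: a smooth vector bundle map
`B ×_Ad Lie G' → B ×_Ad iℝ = X × iℝ` which is the identity on `B ×_Ad iℝ`. It is given by its
expression `L`, `[b, Y] ↦ [b, L b Y]`. Here `B ×_Ad Lie G'` is the quotient of `B × Lie G'` by
`(b, Y) ∼ (b q(γ), Ad_{γ⁻¹} Y)` for `γ ∈ G'`, and `G` acts trivially on `iℝ`, so the map is well
defined exactly when `L` is constant on these classes. -/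
structure IsSplitting (ι : Circle →* G') (q : G' →* G) (act : B → G → B)
    (L : B → E' →L[ℝ] LieT) : Prop where
  smooth : ContMDiff 𝓘(ℝ, EB) 𝓘(ℝ, E' →L[ℝ] LieT) ∞ L
  invariant : ∀ b γ Y, L (act b (q γ)) (Ad γ⁻¹ Y) = L b Y
  identity : ∀ b z, L b (lieMap ι z) = z

/-- `(B', r)` is a lifting of the `G`-bundle `B`, for `B'` a principal `G'`-bundle: `r : B' → B` is
a smooth map over `X` with `r (b γ) = r(b) q(γ)`. -/
structure IsLifting (q : G' →* G) (π : B → X) (act : B → G → B) (π' : B' → X)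
    (act' : B' → G' → B') (r : B' → B) : Prop where
  smooth : ContMDiff 𝓘(ℝ, EB') 𝓘(ℝ, EB) ∞ r
  proj : ∀ b, π (r b) = π' b
  equivariant : ∀ b γ, r (act' b γ) = act (r b) (q γ)

/-- A connection `θ'` on the lifting is compatible with `θ`: `q_* θ' = r^* θ`. -/
def IsCompatible (q : G' →* G) (r : B' → B) (θ : DForm EB B 1 E) (θ' : DForm EB' B' 1 E') : Prop :=
  mapForm (lieMap q) θ' = pullback 𝓘(ℝ, EB') 𝓘(ℝ, EB) r θ

/-- `K`, a smooth `iℝ`-valued `2`-form on `X`, is the scalar curvature `L ∘ F_θ'` of the connection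
`θ'` on the lifting, where `F_θ'` is regarded as the `2`-form on `X` with values in
`B' ×_Ad Lie G' ≅ B ×_Ad Lie G'` that sends `(π'_* V, π'_* W)` to `[r b, F_θ'(b; V, W)]` for
`V, W ∈ T_b B'`. -/
structure IsScalarCurvature (L : B → E' →L[ℝ] LieT) (G' : Type*) [TopologicalSpace G']
    [ChartedSpace E' G'] [Group G'] [LieGroup 𝓘(ℝ, E') ∞ G'] (π' : B' → X) (r : B' → B)
    (θ' : DForm EB' B' 1 E') (K : DForm EX X 2 LieT) : Prop where
  smooth : IsSmoothForm 𝓘(ℝ, EX) K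
  pullback_eq : pullback 𝓘(ℝ, EB') 𝓘(ℝ, EX) π' K = fun b =>
    (L (r b)).compContinuousAlternatingMap (curvature 𝓘(ℝ, EB') G' θ' b)

/-- The `iℝ`-valued `1`-form `N = θ' - σ (r^* θ)` on `B'`. -/
noncomputable def verticalPart (ι : Circle →* G') (σ : E →L[ℝ] E') (r : B' → B)
    (θ : DForm EB B 1 E) (θ' : DForm EB' B' 1 E') : DForm EB' B' 1 LieT :=
  mapForm (centralCoord ι) (θ' - mapForm σ (pullback 𝓘(ℝ, EB') 𝓘(ℝ, EB) r θ))

/-- `F`, a smooth `iℝ`-valued `2`-form on the base `B` of a `𝕋`-bundle `r : B' → B`, is the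
curvature of the connection `N` on this bundle, regarded as a form on the base. -/
structure IsBaseCurvature (r : B' → B) (N : DForm EB' B' 1 LieT) (F : DForm EB B 2 LieT) :
    Prop where
  smooth : IsSmoothForm 𝓘(ℝ, EB) F
  pullback_eq : pullback 𝓘(ℝ, EB') 𝓘(ℝ, EB) r F = curvature 𝓘(ℝ, EB') Circle N

/-! ## The lifting bundle gerbe with its connection and curving -/

/-- The total space of the `𝕋`-bundle `J_B = ζ^* G' → B^[2]` of the lifting bundle gerbe, where
`b₁ ζ(b₁, b₂) = b₂`. A point of `J_B` is a triple `(b₁, b₂, γ)` with `b₁ q(γ) = b₂`; it is given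
here by `(b₁, γ)`, and this bijection gives `J_B` its manifold structure. -/
abbrev LiftingGerbe (B G' : Type*) : Type _ := B × G'

/-- The composite `J_B → B^[2] → B` of the bundle projection with `π₁ : (b₁, b₂) ↦ b₁`. -/
def gerbeFst : LiftingGerbe B G' → B := fun p => p.1

/-- The composite `J_B → B^[2] → B` of the bundle projection with `π₂ : (b₁, b₂) ↦ b₂ = b₁ q(γ)`. -/
def gerbeSnd (q : G' →* G) (act : B → G → B) : LiftingGerbe B G' → B := fun p => act p.1 (q p.2)

/-- The connection `∇_{θ,σ} = ζ^* ν_σ + Z_σ(ζ⁻¹, π₁^* θ)` on the lifting bundle gerbe. -/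
noncomputable def gerbeConnection (ι : Circle →* G') (q : G' →* G) (σ : E →L[ℝ] E')
    (θ : DForm EB B 1 E) : DForm (EB × E') (LiftingGerbe B G') 1 LieT :=
  pullback (𝓘(ℝ, EB).prod 𝓘(ℝ, E')) 𝓘(ℝ, E') Prod.snd (extensionConnection ι q σ) +
    fun p => (groupCocycle ι q σ p.2⁻¹).compContinuousAlternatingMap
      (pullback (𝓘(ℝ, EB).prod 𝓘(ℝ, E')) 𝓘(ℝ, EB) gerbeFst θ p)

/-- The reduced splitting `ℓ_σ(b, Y) = L(b, σ Y)` induced by a splitting. -/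
noncomputable def reducedSplitting (L : B → E' →L[ℝ] LieT) (σ : E →L[ℝ] E') (b : B) :
    E →L[ℝ] LieT := L b ∘L σ

/-- The `2`-form `κ_{θ,σ}(b; V, W) = ℓ_σ(b, F_θ(b; V, W))` on `B`. -/
noncomputable def kappa (G : Type*) [TopologicalSpace G] [ChartedSpace E G] [Group G]
    [LieGroup 𝓘(ℝ, E) ∞ G] (L : B → E' →L[ℝ] LieT) (σ : E →L[ℝ] E') (θ : DForm EB B 1 E) :
    DForm EB B 2 LieT := fun b =>
  (reducedSplitting L σ b).compContinuousAlternatingMap (curvature 𝓘(ℝ, EB) G θ b)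

/-- The curving `f_{θ,σ} = -½ ω_σ(θ, θ) - κ_{θ,σ}` of the lifting bundle gerbe. -/
noncomputable def curving (G : Type*) [TopologicalSpace G] [ChartedSpace E G] [Group G]
    [LieGroup 𝓘(ℝ, E) ∞ G] (ι : Circle →* G') (L : B → E' →L[ℝ] LieT) (σ : E →L[ℝ] E')
    (θ : DForm EB B 1 E) : DForm EB B 2 LieT :=
  -((1 / 2 : ℝ) • wedge (lieCocycle G ι σ) θ θ) - kappa G L σ θ

/-- `f` is a curving for the connection `A` on the lifting bundle gerbe:
`F_A = - π₁^* f + π₂^* f`, an equality of forms pulled back from `B^[2]` to `J_B`. -/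
def IsCurving (q : G' →* G) (act : B → G → B)
    (A : DForm (EB × E') (LiftingGerbe B G') 1 LieT) (f : DForm EB B 2 LieT) : Prop :=
  curvature (𝓘(ℝ, EB).prod 𝓘(ℝ, E')) Circle A =
    -pullback (𝓘(ℝ, EB).prod 𝓘(ℝ, E')) 𝓘(ℝ, EB) gerbeFst f +
      pullback (𝓘(ℝ, EB).prod 𝓘(ℝ, E')) 𝓘(ℝ, EB) (gerbeSnd q act) f

/-- `Ξ` is the `3`-curvature of the lifting bundle gerbe over `X` with connection `A` and curving
`f`: the smooth `3`-form on `X` with `df = π^* Ξ`. -/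
structure IsThreeCurvature (q : G' →* G) (π : B → X) (act : B → G → B)
    (A : DForm (EB × E') (LiftingGerbe B G') 1 LieT) (f : DForm EB B 2 LieT)
    (Ξ : DForm EX X 3 LieT) : Prop where
  isCurving : IsCurving q act A f
  smooth : IsSmoothForm 𝓘(ℝ, EX) Ξ
  dForm_eq : dForm 𝓘(ℝ, EB) f = pullback 𝓘(ℝ, EB) 𝓘(ℝ, EX) π Ξ

end CentralExtensions

end LiftingProblem

set_option linter.unusedSectionVars false

/-! Write `p` for `verticalProj`, the projection of Lie G' onto iℝ along the image of σ. Everything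
rests on how `p` meets the group structure. Because iℝ is central, p[Y, Z] depends only on q_*Y and
q_*Z and equals ω_σ(q_*Y, q_*Z) (`verticalProj_lieBracket`), and p(Ad_γ Y) = Z_σ(γ, q_*Y) + p(Y)
(`verticalProj_Ad`). Compatibility of θ' with θ turns N into p ∘ θ', and `p` is a constant linear
map, so dN = p ∘ dθ'.

Formula for f: applying `p` to the structure equation of θ' gives p(F_θ') = dN + ½ r^*ω_σ(θ, θ). Now
split F_θ' = σ(r^*F_θ) + p(F_θ') and apply L, which is the identity on iℝ. The result is r^*f = dN -
L(F_θ') (`pullback_curving`). The right side is also r^*(F_N - π^*K), and r^* is injective because r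
is a principal circle bundle, hence a surjective map with smooth local sections
(`IsLifting.isPrincipalBundle`).

Curving and 3-curvature: pulled back along B' × G' → B × G' = J_B, the gerbe connection is the
difference of the pull-backs of N along the action and the first projection
(`pullback_gerbeConnection`). Its curvature is therefore the difference of the two pull-backs of
F_N. The term π^*K cancels since both maps J_B → B agree after π. Finally dF_N = 0, because r^*F_N =
dN; hence df = -π^*dK, and injectivity of π^* leaves Ξ = -dK as the only choice.

The groups are modelled on Banach spaces, and the calculus uses charts and no flows. The bracket
enters through the Maurer-Cartan equation at 1 (`dForm_maurerCartan_one`). A general formula for dθ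
on fundamental vectors, applied to the Maurer-Cartan form as a connection for right translation,
identifies the derivative of Ad with the bracket (`fderiv_Ad_inv`). Fed back into the same formula,
this makes every curvature horizontal, which is what descent to the base requires. -/

namespace LiftingProblem

open Set Filter

/-! ## Smoothness of operations on alternating maps -/

section Alternating

variable {E : Type*} [NormedAddCommGroup E] [NormedSpace ℝ E]
  {E' : Type*} [NormedAddCommGroup E'] [NormedSpace ℝ E']
  {F : Type*} [NormedAddCommGroup F] [NormedSpace ℝ F]
  {F' : Type*} [NormedAddCommGroup F'] [NormedSpace ℝ F']
  {F'' : Type*} [NormedAddCommGroup F''] [NormedSpace ℝ F'']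
  {V : Type*} [NormedAddCommGroup V] [NormedSpace ℝ V]
  {k : ℕ}

/-- The alternatization of multilinear maps as a continuous linear map. -/
theorem exists_alternatizationCLM :
    ∃ T : ContinuousMultilinearMap ℝ (fun _ : Fin k => E) F →L[ℝ] E [⋀^Fin k]→L[ℝ] F,
      ∀ f, T f = ContinuousMultilinearMap.alternatization f := by
  let T : ContinuousMultilinearMap ℝ (fun _ : Fin k => E) F →ₗ[ℝ] E [⋀^Fin k]→L[ℝ] F :=
    { toFun := ContinuousMultilinearMap.alternatization
      map_add' := map_add _
      map_smul' := fun c f => by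
        ext v
        simp [ContinuousMultilinearMap.alternatization_apply_apply, Finset.smul_sum, smul_comm c] }
  refine ⟨T.mkContinuous (Fintype.card (Equiv.Perm (Fin k))) fun f => ?_, fun f => rfl⟩
  refine ContinuousMultilinearMap.opNorm_le_bound (by positivity) fun v => ?_
  change ‖ContinuousMultilinearMap.alternatization f v‖ ≤ _
  rw [ContinuousMultilinearMap.alternatization_apply_apply]
  refine (norm_sum_le _ _).trans ?_
  rw [mul_assoc, ← nsmul_eq_mul]
  refine Finset.sum_le_card_nsmul _ _ _ fun s _ => ?_
  have h : ‖Equiv.Perm.sign s • f (v ∘ s)‖ = ‖f (v ∘ s)‖ := by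
    rcases Int.units_eq_one_or (Equiv.Perm.sign s) with h | h <;> simp [h]
  rw [h]
  refine (f.le_opNorm _).trans_eq ?_
  congr 1
  exact Equiv.prod_comp s fun i => ‖v i‖

/-- Inserting `A` in all `k` slots is a continuous multilinear expression in `A`, but with values in
multilinear maps. An alternating map is `1/k!` times its own alternatization, so the continuous
linear map `T` carries smoothness over to the space of alternating maps. -/
theorem contDiff_compContinuousLinearMap {n : ℕ∞ω} :
    ContDiff ℝ n fun p : (E' [⋀^Fin k]→L[ℝ] F) × (E →L[ℝ] E') =>
      p.1.compContinuousLinearMap p.2 := by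
  obtain ⟨T, hT⟩ := exists_alternatizationCLM (E := E) (F := F) (k := k)
  have key : (fun p : (E' [⋀^Fin k]→L[ℝ] F) × (E →L[ℝ] E') => p.1.compContinuousLinearMap p.2) =
      fun p => ((k.factorial : ℝ)⁻¹) •
        T (ContinuousMultilinearMap.compContinuousLinearMapContinuousMultilinear ℝ
          (fun _ : Fin k => E) (fun _ : Fin k => E') F (fun _ => p.2)
          (ContinuousAlternatingMap.toContinuousMultilinearMapCLM ℝ p.1)) := by
    funext p
    have hk : (k.factorial : ℝ) ≠ 0 := Nat.cast_ne_zero.2 (Nat.factorial_ne_zero k)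
    rw [eq_inv_smul_iff₀ hk]
    ext v
    rw [hT, ContinuousMultilinearMap.alternatization_apply_apply]
    have h : ∀ s : Equiv.Perm (Fin k), Equiv.Perm.sign s •
        p.1.compContinuousLinearMap p.2 (v ∘ s) = p.1.compContinuousLinearMap p.2 v := by
      intro s
      have := (p.1.compContinuousLinearMap p.2).toAlternatingMap.map_perm v s
      rw [show p.1.compContinuousLinearMap p.2 (v ∘ s) = _ from this, smul_smul]
      simp
    refine Eq.trans ?_ (Finset.sum_congr rfl fun s _ => (h s).symm)
    simp [Fintype.card_perm, Nat.cast_smul_eq_nsmul]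
  rw [key]
  have hTs : ContDiff ℝ n T := T.contDiff
  refine (hTs.comp ?_).const_smul _
  refine ContDiff.clm_apply ?_ ?_
  · have h := (ContinuousMultilinearMap.compContinuousLinearMapContinuousMultilinear ℝ
      (fun _ : Fin k => E) (fun _ : Fin k => E') F).contDiff (n := n)
    exact h.comp (contDiff_pi.2 fun _ => contDiff_snd)
  · let S : (E' [⋀^Fin k]→L[ℝ] F) →L[ℝ] ContinuousMultilinearMap ℝ (fun _ : Fin k => E') F :=
      ContinuousAlternatingMap.toContinuousMultilinearMapCLM ℝ
    have hS : ContDiff ℝ n S := S.contDiff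
    exact hS.comp contDiff_fst

theorem _root_.ContDiffAt.compContinuousLinearMap_alternating {n : ℕ∞ω} {x : V}
    {η : V → E' [⋀^Fin k]→L[ℝ] F} {A : V → E →L[ℝ] E'} (hη : ContDiffAt ℝ n η x)
    (hA : ContDiffAt ℝ n A x) :
    ContDiffAt ℝ n (fun y => (η y).compContinuousLinearMap (A y)) x :=
  contDiff_compContinuousLinearMap.contDiffAt.comp x (hη.prodMk hA)

theorem _root_.ContDiffAt.compContinuousAlternatingMap {n : ℕ∞ω} {x : V}
    {η : V → E [⋀^Fin k]→L[ℝ] F} {A : V → F →L[ℝ] F'} (hη : ContDiffAt ℝ n η x)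
    (hA : ContDiffAt ℝ n A x) :
    ContDiffAt ℝ n (fun y => (A y).compContinuousAlternatingMap (η y)) x := by
  let T : (F →L[ℝ] F') →L[ℝ] (E [⋀^Fin k]→L[ℝ] F) →L[ℝ] E [⋀^Fin k]→L[ℝ] F' :=
    ContinuousLinearMap.compContinuousAlternatingMapCLM ℝ E F F' (Fin k)
  have hT : ContDiff ℝ n T := by apply ContinuousLinearMap.contDiff
  exact (hT.contDiffAt.comp x hA).clm_apply hη

theorem contDiff_oneForm {n : ℕ∞ω} :
    ContDiff ℝ n fun α : E [⋀^Fin 1]→L[ℝ] F => oneForm α :=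
  (ContinuousAlternatingMap.ofSubsingletonLIE (𝕜 := ℝ) (E := E) (F := F) (0 : Fin 1)
    ).symm.contDiff

theorem _root_.ContDiffAt.bilinearComp {n : ℕ∞ω} (c : F →L[ℝ] F' →L[ℝ] F'') {α : V → E →L[ℝ] F}
    {β : V → E →L[ℝ] F'} {x : V} (hα : ContDiffAt ℝ n α x) (hβ : ContDiffAt ℝ n β x) :
    ContDiffAt ℝ n (fun y => c.bilinearComp (α y) (β y)) x := by
  let T : (E →L[ℝ] F') →L[ℝ] (F' →L[ℝ] F'') →L[ℝ] (E →L[ℝ] F'') :=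
    (ContinuousLinearMap.compL ℝ E F' F'').flip
  have hT : ContDiff ℝ n T := by apply ContinuousLinearMap.contDiff
  have h1 : ContDiffAt ℝ n (fun y => T (β y)) x := hT.contDiffAt.comp x hβ
  have h2 : ContDiffAt ℝ n (fun y => c ∘L α y) x := contDiffAt_const.clm_comp hα
  have h3 : ContDiffAt ℝ n (fun y => T (β y) ∘L (c ∘L α y)) x := h1.clm_comp h2
  exact h3

/-- The exterior product of two `1`-forms at a point depends smoothly on the forms. -/
theorem _root_.ContDiffAt.wedge {n : ℕ∞ω} (c : F →L[ℝ] F' →L[ℝ] F'') {α : V → E [⋀^Fin 1]→L[ℝ] F}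
    {β : V → E [⋀^Fin 1]→L[ℝ] F'} {x : V} (hα : ContDiffAt ℝ n α x) (hβ : ContDiffAt ℝ n β x) :
    ContDiffAt ℝ n (wedge c α β) x := by
  let T : (E →L[ℝ] E [⋀^Fin 1]→L[ℝ] F'') →L[ℝ] E [⋀^Fin 2]→L[ℝ] F'' :=
    ContinuousAlternatingMap.alternatizeUncurryFinCLM ℝ E F''
  have hT : ContDiff ℝ n T := by apply ContinuousLinearMap.contDiff
  have h1 : ContDiffAt ℝ n (fun y => oneForm (α y)) x := contDiff_oneForm.contDiffAt.comp x hα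
  have h2 : ContDiffAt ℝ n (fun y => oneForm (β y)) x := contDiff_oneForm.contDiffAt.comp x hβ
  have h3 : ContDiffAt ℝ n (fun y => c.bilinearComp (oneForm (α y)) (oneForm (β y))) x :=
    ContDiffAt.bilinearComp c h1 h2
  have h : ContDiffAt ℝ n (fun y =>
      (ContinuousAlternatingMap.ofSubsingletonLIE (𝕜 := ℝ) (E := E) (F := F'') (0 : Fin 1)
        ).toContinuousLinearEquiv.toContinuousLinearMap ∘L
          (c.bilinearComp (oneForm (α y)) (oneForm (β y)))) x :=
    contDiffAt_const.clm_comp h3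
  exact hT.contDiffAt.comp x h

theorem form_one_ext {α β : E [⋀^Fin 1]→L[ℝ] F} (h : ∀ v, α ![v] = β ![v]) : α = β := by
  ext v
  have : v = ![v 0] := by ext i; fin_cases i; rfl
  rw [this]
  exact h _

theorem form_two_ext {α β : E [⋀^Fin 2]→L[ℝ] F} (h : ∀ v w, α ![v, w] = β ![v, w]) : α = β := by
  ext v
  have : v = ![v 0, v 1] := by ext i; fin_cases i <;> rfl
  rw [this]
  exact h _ _

theorem compContinuousLinearMap_one (α : E' [⋀^Fin 1]→L[ℝ] F) (A : E →L[ℝ] E') (v : E) :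
    α.compContinuousLinearMap A ![v] = α ![A v] := by
  rw [ContinuousAlternatingMap.compContinuousLinearMap_apply]
  congr 1
  ext i; fin_cases i; rfl

theorem compContinuousLinearMap_two (α : E' [⋀^Fin 2]→L[ℝ] F) (A : E →L[ℝ] E') (v w : E) :
    α.compContinuousLinearMap A ![v, w] = α ![A v, A w] := by
  rw [ContinuousAlternatingMap.compContinuousLinearMap_apply]
  congr 1
  ext i; fin_cases i <;> rfl

theorem extDeriv_compContinuousAlternatingMap (A : F →L[ℝ] F') {η : V → V [⋀^Fin k]→L[ℝ] F} {x : V}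
    (h : DifferentiableAt ℝ η x) :
    extDeriv (fun y => A.compContinuousAlternatingMap (η y)) x =
      A.compContinuousAlternatingMap (extDeriv η x) := by
  have hf : fderiv ℝ (fun y => A.compContinuousAlternatingMap (η y)) x =
      (ContinuousLinearMap.compContinuousAlternatingMapCLM ℝ V F F' (Fin k) A) ∘L fderiv ℝ η x :=
    ((ContinuousLinearMap.compContinuousAlternatingMapCLM ℝ V F F' (Fin k) A).hasFDerivAt.comp x
      h.hasFDerivAt).fderiv
  ext v
  simp [extDeriv, hf, ContinuousAlternatingMap.alternatizeUncurryFin_apply]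

theorem extDeriv_one_apply {η : V → V [⋀^Fin 1]→L[ℝ] F} {x : V} (h : DifferentiableAt ℝ η x)
    (v w : V) : extDeriv η x ![v, w] =
      fderiv ℝ (fun y => η y ![w]) x v - fderiv ℝ (fun y => η y ![v]) x w := by
  rw [extDeriv_apply h, Fin.sum_univ_two]
  have h0 : (0 : Fin 2).removeNth ![v, w] = ![w] := by ext i; fin_cases i; rfl
  have h1 : (1 : Fin 2).removeNth ![v, w] = ![v] := by ext i; fin_cases i; rfl
  simp [h0, h1, sub_eq_add_neg]

end Alternating

/-! ## The tangent map with values in the model spaces -/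

section Tangent

variable {E : Type*} [NormedAddCommGroup E] [NormedSpace ℝ E]
  {H : Type*} [TopologicalSpace H] (I : ModelWithCorners ℝ E H)
  {M : Type*} [TopologicalSpace M] [ChartedSpace H M]
  {E' : Type*} [NormedAddCommGroup E'] [NormedSpace ℝ E']
  {H' : Type*} [TopologicalSpace H'] (I' : ModelWithCorners ℝ E' H')
  {M' : Type*} [TopologicalSpace M'] [ChartedSpace H' M']
  {E'' : Type*} [NormedAddCommGroup E''] [NormedSpace ℝ E'']
  {H'' : Type*} [TopologicalSpace H''] (I'' : ModelWithCorners ℝ E'' H'')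
  {M'' : Type*} [TopologicalSpace M''] [ChartedSpace H'' M'']
  {F : Type*} [NormedAddCommGroup F] [NormedSpace ℝ F]
  {F' : Type*} [NormedAddCommGroup F'] [NormedSpace ℝ F']
  {F'' : Type*} [NormedAddCommGroup F''] [NormedSpace ℝ F'']
  {k : ℕ}

/-- The derivative of `f` at `x` as a map of the model spaces, of which the tangent spaces are
copies. -/
noncomputable def tderiv (f : M → M') (x : M) : E →L[ℝ] E' := mfderiv I I' f x

variable {I I' I''}

theorem pullback_apply (f : M → M') (η : DForm E' M' k F) (x : M) :
    pullback I I' f η x = (η (f x)).compContinuousLinearMap (tderiv I I' f x) := rfl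

theorem tderiv_comp {g : M' → M''} {f : M → M'} {x : M} (hg : MDifferentiableAt I' I'' g (f x))
    (hf : MDifferentiableAt I I' f x) :
    tderiv I I'' (g ∘ f) x = (tderiv I' I'' g (f x)).comp (tderiv I I' f x) :=
  mfderiv_comp x hg hf

theorem tderiv_comp_apply {g : M' → M''} {f : M → M'} {x : M}
    (hg : MDifferentiableAt I' I'' g (f x)) (hf : MDifferentiableAt I I' f x) (v : E) :
    tderiv I I'' (fun y => g (f y)) x v = tderiv I' I'' g (f x) (tderiv I I' f x v) :=
  congrArg (fun A : E →L[ℝ] E'' => A v) (tderiv_comp hg hf)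

theorem tderiv_congr {f g : M → M'} {x : M} (h : f =ᶠ[𝓝 x] g) :
    tderiv I I' f x = tderiv I I' g x := h.mfderiv_eq

theorem tderiv_id (x : M) : tderiv I I (fun y : M => y) x = ContinuousLinearMap.id ℝ E :=
  mfderiv_id

theorem tderiv_const (x : M) (c : M') : tderiv I I' (fun _ : M => c) x = 0 := mfderiv_const

theorem tderiv_eq_fderiv (f : E → E') (x : E) :
    tderiv 𝓘(ℝ, E) 𝓘(ℝ, E') f x = fderiv ℝ f x := mfderiv_eq_fderiv

theorem tderiv_fst (p : M × M') :
    tderiv (I.prod I') I (Prod.fst : M × M' → M) p = ContinuousLinearMap.fst ℝ E E' :=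
  mfderiv_fst

theorem tderiv_snd (p : M × M') :
    tderiv (I.prod I') I' (Prod.snd : M × M' → M') p = ContinuousLinearMap.snd ℝ E E' :=
  mfderiv_snd

theorem tderiv_prod_apply {f : M × M' → M''} {p : M × M'}
    (hf : MDifferentiableAt (I.prod I') I'' f p) (v : E) (w : E') :
    tderiv (I.prod I') I'' f p (v, w) =
      tderiv I I'' (fun z => f (z, p.2)) p.1 v + tderiv I' I'' (fun z => f (p.1, z)) p.2 w :=
  mfderiv_prod_eq_add_apply hf

theorem tderiv_prodMk {f : M → M'} {g : M → M''} {x : M} (hf : MDifferentiableAt I I' f x)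
    (hg : MDifferentiableAt I I'' g x) (v : E) :
    tderiv I (I'.prod I'') (fun y => (f y, g y)) x v = (tderiv I I' f x v, tderiv I I'' g x v) :=
  congrArg (fun A : E →L[ℝ] E' × E'' => A v) (mfderiv_prodMk hf hg)

theorem _root_.ContMDiffAt.mdiffAt {f : M → M'} {x : M} (h : ContMDiffAt I I' ∞ f x) :
    MDifferentiableAt I I' f x := h.mdifferentiableAt (by simp)

theorem _root_.ContMDiff.mdiffAt {f : M → M'} (h : ContMDiff I I' ∞ f) (x : M) :
    MDifferentiableAt I I' f x := h.contMDiffAt.mdiffAt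

theorem _root_.ContMDiffAt.eventually_mdiffAt [IsManifold I ∞ M] [IsManifold I' ∞ M']
    {f : M → M'} {x : M} (h : ContMDiffAt I I' ∞ f x) :
    ∀ᶠ y in 𝓝 x, MDifferentiableAt I I' f y := by
  have h1 : ContMDiffAt I I' 1 f x := h.of_le (by simp)
  filter_upwards [(contMDiffAt_iff_contMDiffAt_nhds (by simp)).1 h1] with y hy
  exact hy.mdifferentiableAt (by simp)

theorem pullback_congr {f g : M → M'} {x : M} (h : f =ᶠ[𝓝 x] g) (η : DForm E' M' k F) :
    pullback I I' f η x = pullback I I' g η x := by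
  rw [pullback_apply, pullback_apply, tderiv_congr h, h.self_of_nhds]

theorem pullback_comp {g : M' → M''} {f : M → M'} {x : M} (hg : MDifferentiableAt I' I'' g (f x))
    (hf : MDifferentiableAt I I' f x) (η : DForm E'' M'' k F) :
    pullback I I'' (g ∘ f) η x = pullback I I' f (pullback I' I'' g η) x := by
  rw [pullback_apply, tderiv_comp hg hf]
  rfl

theorem pullback_id (η : DForm E M k F) : pullback I I (fun x : M => x) η = η := by
  funext x
  rw [pullback_apply, tderiv_id]
  ext v
  rfl

theorem pullback_neg (f : M → M') (η : DForm E' M' k F) :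
    pullback I I' f (-η) = -pullback I I' f η := rfl

theorem pullback_sub (f : M → M') (η η' : DForm E' M' k F) :
    pullback I I' f (η - η') = pullback I I' f η - pullback I I' f η' := rfl

theorem pullback_one (f : M → M') (η : DForm E' M' 1 F) (x : M) (v : E) :
    pullback I I' f η x ![v] = η (f x) ![tderiv I I' f x v] :=
  compContinuousLinearMap_one _ _ _

theorem pullback_two (f : M → M') (η : DForm E' M' 2 F) (x : M) (v w : E) :
    pullback I I' f η x ![v, w] = η (f x) ![tderiv I I' f x v, tderiv I I' f x w] :=
  compContinuousLinearMap_two _ _ _ _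

/-! ## Charts -/

section Charts

variable [I.Boundaryless] [IsManifold I ∞ M]

theorem contMDiffAt_chart_symm (x : M) {y : E} (hy : y ∈ (extChartAt I x).target) :
    ContMDiffAt 𝓘(ℝ, E) I ∞ (extChartAt I x).symm y :=
  (contMDiffOn_extChartAt_symm x).contMDiffAt ((isOpen_extChartAt_target x).mem_nhds hy)

theorem contMDiffAt_chart (x : M) {y : M} (hy : y ∈ (extChartAt I x).source) :
    ContMDiffAt I 𝓘(ℝ, E) ∞ (extChartAt I x) y :=
  contMDiffAt_extChartAt' (by simpa using hy)

theorem target_mem_nhds (x : M) : (extChartAt I x).target ∈ 𝓝 (extChartAt I x x) :=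
  (isOpen_extChartAt_target x).mem_nhds (mem_extChartAt_target x)

/-- T_x M is identified with `E` through the preferred chart at `x`, so this chart has identity
derivative at its centre. At other points of its source the derivative is a change of charts. -/
theorem tderiv_chart (x : M) : tderiv I 𝓘(ℝ, E) (extChartAt I x) x = ContinuousLinearMap.id ℝ E :=
  mfderiv_extChartAt_self

theorem tderiv_chart_symm (x : M) :
    tderiv 𝓘(ℝ, E) I (extChartAt I x).symm (extChartAt I x x) = ContinuousLinearMap.id ℝ E := by
  have h := tderiv_comp (I := 𝓘(ℝ, E)) (I' := I) (I'' := 𝓘(ℝ, E))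
    (contMDiffAt_chart x ((extChartAt I x).map_target (mem_extChartAt_target x))).mdiffAt
    (contMDiffAt_chart_symm x (mem_extChartAt_target x)).mdiffAt
  rw [extChartAt_to_inv, tderiv_chart, ContinuousLinearMap.id_comp] at h
  rw [← h, tderiv_congr (g := fun y => y), tderiv_id]
  filter_upwards [target_mem_nhds x] with y hy
  exact (extChartAt I x).right_inv hy

end Charts

variable (I) in
theorem formInChart_eq [I.Boundaryless] (x₀ : M)
    (η : DForm E M k F) :
    formInChart I x₀ η = pullback 𝓘(ℝ, E) I (extChartAt I x₀).symm η := by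
  funext y
  rw [formInChart, I.range_eq_univ, mfderivWithin_univ]
  rfl

end Tangent

/-! ## Smooth forms, their pull-backs and their exterior derivatives -/

section SmoothForms

variable {E : Type*} [NormedAddCommGroup E] [NormedSpace ℝ E]
  {H : Type*} [TopologicalSpace H] {I : ModelWithCorners ℝ E H} [I.Boundaryless]
  {M : Type*} [TopologicalSpace M] [ChartedSpace H M] [IsManifold I ∞ M]
  {E' : Type*} [NormedAddCommGroup E'] [NormedSpace ℝ E']
  {H' : Type*} [TopologicalSpace H'] {I' : ModelWithCorners ℝ E' H'} [I'.Boundaryless]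
  {M' : Type*} [TopologicalSpace M'] [ChartedSpace H' M'] [IsManifold I' ∞ M']
  {F : Type*} [NormedAddCommGroup F] [NormedSpace ℝ F]
  {F' : Type*} [NormedAddCommGroup F'] [NormedSpace ℝ F']
  {F'' : Type*} [NormedAddCommGroup F''] [NormedSpace ℝ F'']
  {k : ℕ}

variable (I) in
/-- A form is smooth at `x` if its expression in the preferred chart around `x` is. -/
def SmoothFormAt (η : DForm E M k F) (x : M) : Prop :=
  ContDiffAt ℝ ∞ (formInChart I x η) (extChartAt I x x)

theorem minSmoothness_two_le : minSmoothness ℝ 2 ≤ ∞ := by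
  rw [minSmoothness_of_isRCLikeNormedField]
  exact WithTop.coe_le_coe.2 le_top

/-- Pull-back commutes with passing to charts. This reduces smoothness and exterior derivatives of
pull-backs to calculus on the model spaces. -/
theorem formInChart_pullback {f : M → M'} {x : M} (hf : ContMDiffAt I I' ∞ f x)
    (η : DForm E' M' k F) :
    formInChart I x (pullback I I' f η) =ᶠ[𝓝 (extChartAt I x x)] fun y =>
      (formInChart I' (f x) η ((extChartAt I' (f x) ∘ f ∘ (extChartAt I x).symm) y)
        ).compContinuousLinearMap
          (fderiv ℝ (extChartAt I' (f x) ∘ f ∘ (extChartAt I x).symm) y) := by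
  have hsymm : Tendsto (extChartAt I x).symm (𝓝 (extChartAt I x x)) (𝓝 x) := by
    simpa using (continuousAt_extChartAt_symm (I := I) x).tendsto
  have h1 : ∀ᶠ y in 𝓝 (extChartAt I x x), MDifferentiableAt I I' f ((extChartAt I x).symm y) :=
    hsymm.eventually hf.eventually_mdiffAt
  have h2 : ∀ᶠ y in 𝓝 (extChartAt I x x),
      f ((extChartAt I x).symm y) ∈ (extChartAt I' (f x)).source :=
    (hf.continuousAt.tendsto.comp hsymm).eventually (extChartAt_source_mem_nhds (f x))
  -- The condition `h2` is needed on a neighbourhood of `y`: the pull-back at `y` involves a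
  -- derivative, so the maps must agree as germs.
  filter_upwards [h1, h2.eventually_nhds, target_mem_nhds (I := I) x] with y hy1 hy2 hy3
  have hφ := (contMDiffAt_chart_symm (I := I) x hy3).mdiffAt
  have hφ' := (contMDiffAt_chart (I := I') (f x) hy2.self_of_nhds).mdiffAt
  have hF : MDifferentiableAt 𝓘(ℝ, E) 𝓘(ℝ, E')
      (extChartAt I' (f x) ∘ f ∘ (extChartAt I x).symm) y :=
    MDifferentiableAt.comp y hφ' (hy1.comp y hφ)
  rw [formInChart_eq, formInChart_eq, ← pullback_comp hy1 hφ, ← tderiv_eq_fderiv]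
  have h3 := (contMDiffAt_chart_symm (I := I') (f x)
    ((extChartAt I' (f x)).map_source hy2.self_of_nhds)).mdiffAt
  refine Eq.trans (pullback_congr ?_ η) (pullback_comp (I' := 𝓘(ℝ, E'))
    (g := (extChartAt I' (f x)).symm) (f := extChartAt I' (f x) ∘ f ∘ (extChartAt I x).symm) h3 hF η)
  filter_upwards [hy2] with z hz
  exact ((extChartAt I' (f x)).left_inv hz).symm

theorem contDiffAt_inCharts {f : M → M'} {x : M} (hf : ContMDiffAt I I' ∞ f x) :
    ContDiffAt ℝ ∞ (extChartAt I' (f x) ∘ f ∘ (extChartAt I x).symm) (extChartAt I x x) := by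
  have h1 : ContMDiffAt 𝓘(ℝ, E) 𝓘(ℝ, E') ∞ (extChartAt I' (f x) ∘ f ∘ (extChartAt I x).symm)
      (extChartAt I x x) := by
    refine ContMDiffAt.comp (I' := I') _ ?_ (ContMDiffAt.comp (I' := I) _ ?_ ?_)
    · simpa using contMDiffAt_chart (I := I') (f x) (mem_extChartAt_source (f x))
    · simpa using hf
    · exact contMDiffAt_chart_symm x (mem_extChartAt_target x)
  exact h1.contDiffAt

theorem SmoothFormAt.pullback {f : M → M'} {x : M} {η : DForm E' M' k F}
    (hη : SmoothFormAt I' η (f x)) (hf : ContMDiffAt I I' ∞ f x) :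
    SmoothFormAt I (pullback I I' f η) x := by
  refine ContDiffAt.congr_of_eventuallyEq ?_ (formInChart_pullback hf η)
  have hF := contDiffAt_inCharts hf
  have hF' : ContDiffAt ℝ ∞ (fderiv ℝ (extChartAt I' (f x) ∘ f ∘ (extChartAt I x).symm))
      (extChartAt I x x) := hF.fderiv_right (by simp)
  have hη' : ContDiffAt ℝ ∞ (formInChart I' (f x) η)
      ((extChartAt I' (f x) ∘ f ∘ (extChartAt I x).symm) (extChartAt I x x)) := by
    simpa [SmoothFormAt] using hη
  have hη'' := hη'.comp (extChartAt I x x) hF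
  exact hη''.compContinuousLinearMap_alternating hF'

theorem tendsto_chart_symm (x : M) :
    Tendsto (extChartAt I x).symm (𝓝 (extChartAt I x x)) (𝓝 x) := by
  simpa using (continuousAt_extChartAt_symm (I := I) x).tendsto

theorem formInChart_congr {x : M} {η η' : DForm E M k F} (h : η =ᶠ[𝓝 x] η') :
    formInChart I x η =ᶠ[𝓝 (extChartAt I x x)] formInChart I x η' := by
  filter_upwards [(tendsto_chart_symm (I := I) x).eventually h] with y hy
  rw [formInChart, formInChart, hy]

theorem SmoothFormAt.congr {x : M} {η η' : DForm E M k F} (hη : SmoothFormAt I η x)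
    (h : η' =ᶠ[𝓝 x] η) : SmoothFormAt I η' x :=
  ContDiffAt.congr_of_eventuallyEq hη (formInChart_congr h)

theorem smoothFormAt_vectorSpace {η : DForm E E k F} {x : E} :
    SmoothFormAt 𝓘(ℝ, E) η x ↔ ContDiffAt ℝ ∞ η x := by
  rw [SmoothFormAt, formInChart_eq]
  simp only [extChartAt_model_space_eq_id, PartialEquiv.refl_symm, PartialEquiv.refl_coe]
  rw [show pullback 𝓘(ℝ, E) 𝓘(ℝ, E) id η = η from pullback_id η]
  rfl

/-- Independence of charts: at a point `y` away from the centre, the expression in the chart is the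
pull-back of `η` under the inverse chart, whose smoothness there follows from smoothness of `η` at
the image point. -/
theorem isSmoothForm_iff {η : DForm E M k F} : IsSmoothForm I η ↔ ∀ x, SmoothFormAt I η x := by
  refine ⟨fun h x => (h x).contDiffAt (target_mem_nhds x), fun h x _ hy => ?_⟩
  have h1 : SmoothFormAt 𝓘(ℝ, E) (LiftingProblem.pullback 𝓘(ℝ, E) I (extChartAt I x).symm η) _ :=
    (h _).pullback (contMDiffAt_chart_symm x hy)
  rw [formInChart_eq]
  exact (smoothFormAt_vectorSpace.1 h1).contDiffWithinAt

theorem dForm_eq (η : DForm E M k F) (x : M) :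
    dForm I η x = extDeriv (formInChart I x η) (extChartAt I x x) := by
  rw [dForm, I.range_eq_univ, extDerivWithin_univ]
  have h : (mfderiv I 𝓘(ℝ, E) (extChartAt I x) x : E →L[ℝ] E) = ContinuousLinearMap.id ℝ E :=
    tderiv_chart x
  rw [h]
  ext v
  rfl

/-- Only the charts centred at `x` and `f x` enter, and their derivatives at the centres are
identities. What remains is the naturality of `extDeriv` under the expression of `f` in these
charts. -/
theorem dForm_pullback {f : M → M'} {x : M} {η : DForm E' M' k F}
    (hη : SmoothFormAt I' η (f x)) (hf : ContMDiffAt I I' ∞ f x) :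
    dForm I (pullback I I' f η) x = pullback I I' f (dForm I' η) x := by
  have hF := contDiffAt_inCharts hf
  have hx : (extChartAt I' (f x) ∘ f ∘ (extChartAt I x).symm) (extChartAt I x x) =
      extChartAt I' (f x) (f x) := by simp
  have hη' : DifferentiableAt ℝ (formInChart I' (f x) η)
      ((extChartAt I' (f x) ∘ f ∘ (extChartAt I x).symm) (extChartAt I x x)) := by
    rw [hx]
    exact ContDiffAt.differentiableAt hη (by simp)
  rw [dForm_eq, (formInChart_pullback hf η).extDeriv_eq,
    extDeriv_pullback hη' hF minSmoothness_two_le, hx,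
    pullback_apply, dForm_eq]
  congr 1
  rw [← tderiv_eq_fderiv]
  have h1 : MDifferentiableAt 𝓘(ℝ, E) I' (f ∘ (extChartAt I x).symm) (extChartAt I x x) := by
    refine MDifferentiableAt.comp (I' := I) _ ?_
      (contMDiffAt_chart_symm x (mem_extChartAt_target x)).mdiffAt
    simpa using hf.mdiffAt
  have h2 : MDifferentiableAt I' 𝓘(ℝ, E') (extChartAt I' (f x))
      ((f ∘ (extChartAt I x).symm) (extChartAt I x x)) := by
    simpa using (contMDiffAt_chart (I := I') (f x) (mem_extChartAt_source (f x))).mdiffAt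
  rw [tderiv_comp h2 h1, tderiv_comp (I' := I) (by simpa using hf.mdiffAt)
    (contMDiffAt_chart_symm x (mem_extChartAt_target x)).mdiffAt, tderiv_chart_symm]
  simp only [Function.comp_apply, extChartAt_to_inv, tderiv_chart]
  ext v
  rfl

theorem dForm_vectorSpace (η : DForm E E k F) : dForm 𝓘(ℝ, E) η = extDeriv η := by
  funext x
  rw [dForm_eq, formInChart_eq]
  simp only [extChartAt_model_space_eq_id, PartialEquiv.refl_symm, PartialEquiv.refl_coe]
  rw [show pullback 𝓘(ℝ, E) 𝓘(ℝ, E) id η = η from pullback_id η]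
  rfl

/-- The definition of `dForm` changes chart with the point. Naturality under the inverse chart shows
that over a whole chart it is the derivative of one expression, so it can be differentiated again.
-/
theorem formInChart_dForm {η : DForm E M k F} (hη : IsSmoothForm I η) (x : M) {y : E}
    (hy : y ∈ (extChartAt I x).target) :
    formInChart I x (dForm I η) y = extDeriv (formInChart I x η) y := by
  rw [formInChart_eq, formInChart_eq,
    ← dForm_pullback (isSmoothForm_iff.1 hη _) (contMDiffAt_chart_symm x hy), dForm_vectorSpace]

theorem contDiffAt_extDeriv {η : E → E [⋀^Fin k]→L[ℝ] F} {x : E} (hη : ContDiffAt ℝ ∞ η x) :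
    ContDiffAt ℝ ∞ (extDeriv η) x := by
  let T : (E →L[ℝ] E [⋀^Fin k]→L[ℝ] F) →L[ℝ] E [⋀^Fin (k + 1)]→L[ℝ] F :=
    ContinuousAlternatingMap.alternatizeUncurryFinCLM ℝ E F
  have hT : ContDiff ℝ ∞ T := by apply ContinuousLinearMap.contDiff
  have h : ContDiffAt ℝ ∞ (fderiv ℝ η) x := hη.fderiv_right (by simp)
  exact hT.contDiffAt.comp x h

theorem IsSmoothForm.dForm {η : DForm E M k F} (hη : IsSmoothForm I η) :
    IsSmoothForm I (dForm I η) := by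
  refine isSmoothForm_iff.2 fun x => ?_
  have h := contDiffAt_extDeriv ((hη x).contDiffAt (target_mem_nhds x))
  refine h.congr_of_eventuallyEq ?_
  filter_upwards [target_mem_nhds x] with y hy
  exact formInChart_dForm hη x hy

theorem dForm_dForm {η : DForm E M k F} (hη : IsSmoothForm I η) :
    dForm I (dForm I η) = 0 := by
  funext x
  have h : formInChart I x (LiftingProblem.dForm I η) =ᶠ[𝓝 (extChartAt I x x)]
      extDeriv (formInChart I x η) := by
    filter_upwards [target_mem_nhds x] with y hy
    exact formInChart_dForm hη x hy
  rw [dForm_eq, h.extDeriv_eq, extDeriv_extDeriv_apply ((hη x).contDiffAt (target_mem_nhds x))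
    minSmoothness_two_le]
  rfl

/-! ### Linear operations -/

theorem formInChart_add (η η' : DForm E M k F) (x : M) :
    formInChart I x (η + η') = formInChart I x η + formInChart I x η' := rfl

theorem formInChart_neg (η : DForm E M k F) (x : M) :
    formInChart I x (-η) = -formInChart I x η := rfl

theorem SmoothFormAt.add {η η' : DForm E M k F} {x : M} (h : SmoothFormAt I η x)
    (h' : SmoothFormAt I η' x) : SmoothFormAt I (η + η') x :=
  ContDiffAt.add h h'

theorem SmoothFormAt.neg {η : DForm E M k F} {x : M} (h : SmoothFormAt I η x) :
    SmoothFormAt I (-η) x :=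
  ContDiffAt.neg h

theorem SmoothFormAt.const_smul {η : DForm E M k F} {x : M} (c : ℝ) (h : SmoothFormAt I η x) :
    SmoothFormAt I (c • η) x :=
  ContDiffAt.const_smul c h

theorem SmoothFormAt.mapForm (A : F →L[ℝ] F') {η : DForm E M k F} {x : M}
    (h : SmoothFormAt I η x) : SmoothFormAt I (mapForm A η) x :=
  ContDiffAt.compContinuousAlternatingMap h contDiffAt_const

/-- Variable coefficients are needed for the splitting `L`, which depends on the point of the
bundle. -/
theorem SmoothFormAt.coeff {A : M → F →L[ℝ] F'} {η : DForm E M k F} {x : M}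
    (h : SmoothFormAt I η x) (hA : ContMDiffAt I 𝓘(ℝ, F →L[ℝ] F') ∞ A x) :
    SmoothFormAt I (fun y => (A y).compContinuousAlternatingMap (η y)) x := by
  refine ContDiffAt.compContinuousAlternatingMap (A := fun y => A ((extChartAt I x).symm y)) h ?_
  refine ContMDiffAt.contDiffAt (ContMDiffAt.comp (I' := I) _ ?_
    (contMDiffAt_chart_symm x (mem_extChartAt_target x)))
  simpa using hA

theorem SmoothFormAt.wedge (c : F →L[ℝ] F' →L[ℝ] F'') {α : DForm E M 1 F} {β : DForm E M 1 F'}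
    {x : M} (hα : SmoothFormAt I α x) (hβ : SmoothFormAt I β x) :
    SmoothFormAt I (wedge c α β) x := by
  refine (ContDiffAt.wedge c hα hβ).congr_of_eventuallyEq (Eventually.of_forall fun y => ?_)
  refine form_two_ext fun v w => ?_
  simp only [formInChart_eq, pullback_two, wedge_apply, pullback_one]

theorem dForm_add {η η' : DForm E M k F} {x : M} (h : SmoothFormAt I η x)
    (h' : SmoothFormAt I η' x) : dForm I (η + η') x = dForm I η x + dForm I η' x := by
  rw [dForm_eq, dForm_eq, dForm_eq, formInChart_add, extDeriv_add]
  · exact ContDiffAt.differentiableAt h (by simp)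
  · exact ContDiffAt.differentiableAt h' (by simp)

theorem dForm_neg (η : DForm E M k F) (x : M) : dForm I (-η) x = -dForm I η x := by
  rw [dForm_eq, dForm_eq, formInChart_neg, ← neg_one_smul ℝ, extDeriv_smul, neg_one_smul]

theorem dForm_sub {η η' : DForm E M k F} {x : M} (h : SmoothFormAt I η x)
    (h' : SmoothFormAt I η' x) : dForm I (η - η') x = dForm I η x - dForm I η' x := by
  rw [sub_eq_add_neg, dForm_add h h'.neg, dForm_neg, ← sub_eq_add_neg]

theorem dForm_mapForm (A : F →L[ℝ] F') {η : DForm E M k F} {x : M} (h : SmoothFormAt I η x) :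
    dForm I (mapForm A η) x = A.compContinuousAlternatingMap (dForm I η x) := by
  rw [dForm_eq, dForm_eq,
    ← extDeriv_compContinuousAlternatingMap A (ContDiffAt.differentiableAt h (by simp))]
  rfl

end SmoothForms

/-! ## Maurer-Cartan forms and adjoint actions -/

section LieGroups

variable {E : Type*} [NormedAddCommGroup E] [NormedSpace ℝ E]
  {G : Type*} [TopologicalSpace G] [ChartedSpace E G] [Group G] [LieGroup 𝓘(ℝ, E) ∞ G]
  {E' : Type*} [NormedAddCommGroup E'] [NormedSpace ℝ E']
  {G' : Type*} [TopologicalSpace G'] [ChartedSpace E' G'] [Group G'] [LieGroup 𝓘(ℝ, E') ∞ G']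
  {E'' : Type*} [NormedAddCommGroup E''] [NormedSpace ℝ E'']
  {G'' : Type*} [TopologicalSpace G''] [ChartedSpace E'' G''] [Group G'']
  [LieGroup 𝓘(ℝ, E'') ∞ G'']

theorem contMDiff_mulLeft (g : G) : ContMDiff 𝓘(ℝ, E) 𝓘(ℝ, E) ∞ (fun h : G => g * h) :=
  contMDiff_mul_left

theorem contMDiff_mulRight (g : G) : ContMDiff 𝓘(ℝ, E) 𝓘(ℝ, E) ∞ (fun h : G => h * g) :=
  contMDiff_mul_right

theorem contMDiff_conj (g : G) : ContMDiff 𝓘(ℝ, E) 𝓘(ℝ, E) ∞ (fun h : G => g * h * g⁻¹) :=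
  (contMDiff_mulRight g⁻¹).comp (contMDiff_mulLeft g)

theorem lieMap_eq (f : G →* G') : lieMap f = tderiv 𝓘(ℝ, E) 𝓘(ℝ, E') f 1 := rfl

theorem Ad_eq (g : G) : Ad g = tderiv 𝓘(ℝ, E) 𝓘(ℝ, E) (fun h : G => g * h * g⁻¹) 1 := rfl

theorem lieMap_comp {f : G' →* G''} {g : G →* G'} (hf : ContMDiff 𝓘(ℝ, E') 𝓘(ℝ, E'') ∞ f)
    (hg : ContMDiff 𝓘(ℝ, E) 𝓘(ℝ, E') ∞ g) (v : E) :
    lieMap (E := E) (E' := E'') (f.comp g) v =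
      lieMap (E := E') (E' := E'') f (lieMap (E := E) (E' := E') g v) := by
  simp only [lieMap_eq]
  have h := tderiv_comp_apply (hf.mdiffAt (g 1)) (hg.mdiffAt 1) v
  rw [map_one] at h
  exact h

/-- Conjugation is a homomorphism, so the identities for `Ad`, including its compatibility with the
bracket, are instances of the functoriality of `lieMap`. -/
theorem Ad_eq_lieMap (g : G) :
    Ad (E := E) g = lieMap (E := E) (E' := E) (MulAut.conj g).toMonoidHom := rfl

theorem contMDiff_conjHom (g : G) :
    ContMDiff 𝓘(ℝ, E) 𝓘(ℝ, E) ∞ ((MulAut.conj g).toMonoidHom : G →* G) :=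
  contMDiff_conj g

theorem lieMap_Ad {f : G →* G'} (hf : ContMDiff 𝓘(ℝ, E) 𝓘(ℝ, E') ∞ f) (g : G) (v : E) :
    lieMap (E := E) (E' := E') f (Ad g v) = Ad (f g) (lieMap (E := E) (E' := E') f v) := by
  rw [Ad_eq_lieMap, Ad_eq_lieMap, ← lieMap_comp hf (contMDiff_conjHom g),
    ← lieMap_comp (contMDiff_conjHom (f g)) hf]
  congr 2
  ext h
  simp

theorem Ad_of_mem_center {g : G} (hg : g ∈ Subgroup.center G) : Ad g = ContinuousLinearMap.id ℝ E := by
  have h : (fun h : G => g * h * g⁻¹) = fun h => h := by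
    funext h
    rw [← Subgroup.mem_center_iff.1 hg h, mul_inv_cancel_right]
  rw [Ad_eq, h, tderiv_id]

theorem Ad_lieMap_of_central {f : G →* G'} (hf : ContMDiff 𝓘(ℝ, E) 𝓘(ℝ, E') ∞ f)
    (hc : f.range ≤ Subgroup.center G') (g : G') (v : E) :
    Ad g (lieMap (E := E) (E' := E') f v) = lieMap (E := E) (E' := E') f v := by
  rw [Ad_eq_lieMap, ← lieMap_comp (contMDiff_conjHom g) hf]
  congr 2
  ext h
  have hh := Subgroup.mem_center_iff.1 (hc (MonoidHom.mem_range.2 ⟨h, rfl⟩)) g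
  simp [hh]

theorem maurerCartan_apply (g : G) (v : E) :
    maurerCartan E G g ![v] = tderiv 𝓘(ℝ, E) 𝓘(ℝ, E) (fun h : G => g⁻¹ * h) g v := rfl

theorem maurerCartan_mulLeft (g : G) (v : E) :
    maurerCartan E G g ![tderiv 𝓘(ℝ, E) 𝓘(ℝ, E) (fun h : G => g * h) 1 v] = v := by
  have h := tderiv_comp_apply (g := fun h : G => g⁻¹ * h) (f := fun h : G => g * h) (x := 1)
    ((contMDiff_mulLeft (E := E) g⁻¹).mdiffAt _) ((contMDiff_mulLeft (E := E) g).mdiffAt _) v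
  simp only [inv_mul_cancel_left, mul_one, tderiv_id] at h
  rw [maurerCartan_apply]
  exact h.symm

theorem mulLeft_maurerCartan (g : G) (v : E) :
    tderiv 𝓘(ℝ, E) 𝓘(ℝ, E) (fun h : G => g * h) 1 (maurerCartan E G g ![v]) = v := by
  have h := tderiv_comp_apply (g := fun h : G => g * h) (f := fun h : G => g⁻¹ * h) (x := g)
    ((contMDiff_mulLeft (E := E) g).mdiffAt _) ((contMDiff_mulLeft (E := E) g⁻¹).mdiffAt _) v
  simp only [mul_inv_cancel_left, inv_mul_cancel, tderiv_id] at h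
  rw [maurerCartan_apply]
  exact h.symm

theorem maurerCartan_one (v : E) : maurerCartan E G 1 ![v] = v := by
  have h := mulLeft_maurerCartan (1 : G) v
  simp only [one_mul, tderiv_id] at h
  exact h

/-- Differentiate f(g)⁻¹ f(h) = f(g⁻¹ h) in `h` at `g`. -/
theorem pullback_maurerCartan {f : G →* G'} (hf : ContMDiff 𝓘(ℝ, E) 𝓘(ℝ, E') ∞ f) :
    pullback 𝓘(ℝ, E) 𝓘(ℝ, E') f (maurerCartan E' G') = mapForm (lieMap f) (maurerCartan E G) := by
  funext g
  refine form_one_ext fun v => ?_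
  rw [pullback_one, maurerCartan_apply]
  have h1 := tderiv_comp_apply ((contMDiff_mulLeft (E := E') (f g)⁻¹).mdiffAt (f g))
    (hf.mdiffAt g) v
  have h2 := tderiv_comp_apply (f := fun h : G => g⁻¹ * h) (hf.mdiffAt (g⁻¹ * g))
    ((contMDiff_mulLeft (E := E) g⁻¹).mdiffAt g) v
  simp only [map_mul, map_inv, inv_mul_cancel] at h2
  exact h1.symm.trans h2

/-- Differentiate (x g)⁻¹ (h g) = g⁻¹ (x⁻¹ h) g in `h` at `x`. -/
theorem pullback_mulRight_maurerCartan (g : G) :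
    pullback 𝓘(ℝ, E) 𝓘(ℝ, E) (fun h : G => h * g) (maurerCartan E G) =
      mapForm (Ad g⁻¹) (maurerCartan E G) := by
  funext x
  refine form_one_ext fun v => ?_
  rw [pullback_one, maurerCartan_apply]
  have h1 := tderiv_comp_apply (f := fun h : G => h * g)
    ((contMDiff_mulLeft (E := E) (x * g)⁻¹).mdiffAt (x * g))
    ((contMDiff_mulRight (E := E) g).mdiffAt x) v
  have h2 := tderiv_comp_apply (g := fun h : G => g⁻¹ * h * g⁻¹⁻¹) (f := fun h : G => x⁻¹ * h)
    ((contMDiff_conj (E := E) g⁻¹).mdiffAt (x⁻¹ * x))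
    ((contMDiff_mulLeft (E := E) x⁻¹).mdiffAt x) v
  simp only [inv_mul_cancel] at h2
  refine h1.symm.trans (Eq.trans ?_ h2)
  congr 2
  funext h
  group

theorem isSmoothForm_maurerCartan : IsSmoothForm 𝓘(ℝ, E) (maurerCartan E G) := by
  refine isSmoothForm_iff.2 fun g => ?_
  let φ := extChartAt 𝓘(ℝ, E) g
  let ψ := extChartAt 𝓘(ℝ, E) (1 : G)
  -- The form at `y` is the partial derivative of `m` in `z` on the diagonal. There the product is
  -- 1, the centre of `ψ`, so inserting `ψ` does not change the derivative; it only makes `m` a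
  -- smooth family of maps between vector spaces.
  let m : E → E → E := fun y z => ψ ((φ.symm y)⁻¹ * φ.symm z)
  have hφ : ContMDiffAt 𝓘(ℝ, E) 𝓘(ℝ, E) ∞ φ.symm (φ g) :=
    contMDiffAt_chart_symm g (mem_extChartAt_target g)
  have hm : ContDiffAt ℝ ∞ (Function.uncurry m) (φ g, φ g) := by
    refine ContMDiffAt.contDiffAt ?_
    have h1 : ContMDiffAt 𝓘(ℝ, E × E) 𝓘(ℝ, E) ∞ (fun p : E × E => φ.symm p.1) (φ g, φ g) :=
      ContMDiffAt.comp (g := φ.symm) (f := Prod.fst) (I' := 𝓘(ℝ, E)) (φ g, φ g) hφ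
        contDiff_fst.contMDiff.contMDiffAt
    have h2 : ContMDiffAt 𝓘(ℝ, E × E) 𝓘(ℝ, E) ∞ (fun p : E × E => φ.symm p.2) (φ g, φ g) :=
      ContMDiffAt.comp (g := φ.symm) (f := Prod.snd) (I' := 𝓘(ℝ, E)) (φ g, φ g) hφ
        contDiff_snd.contMDiff.contMDiffAt
    have h3 : ContMDiffAt 𝓘(ℝ, E × E) 𝓘(ℝ, E) ∞ (fun p : E × E => (φ.symm p.1)⁻¹ * φ.symm p.2)
      (φ g, φ g) := h1.inv.mul h2
    refine ContMDiffAt.comp (I' := 𝓘(ℝ, E)) (g := ψ) (φ g, φ g) ?_ h3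
    simp only [inv_mul_cancel]
    exact contMDiffAt_chart 1 (mem_extChartAt_source 1)
  have hd : ContDiffAt ℝ ∞ (fun y => fderiv ℝ (m y) y) (φ g) :=
    ContDiffAt.fderiv hm contDiffAt_id (by simp)
  have hS : ContDiff ℝ ∞ (ContinuousAlternatingMap.ofSubsingletonLIE (𝕜 := ℝ) (E := E) (F := E)
    (0 : Fin 1)) := LinearIsometryEquiv.contDiff _
  refine (hS.contDiffAt.comp (φ g) hd).congr_of_eventuallyEq ?_
  filter_upwards [target_mem_nhds (I := 𝓘(ℝ, E)) g] with y hy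
  refine form_one_ext fun v => ?_
  rw [formInChart_eq, pullback_one, maurerCartan_apply]
  have hy' : ContMDiffAt 𝓘(ℝ, E) 𝓘(ℝ, E) ∞ φ.symm y := contMDiffAt_chart_symm g hy
  have h1 := tderiv_comp_apply ((contMDiff_mulLeft (E := E) (φ.symm y)⁻¹).mdiffAt (φ.symm y))
    hy'.mdiffAt v
  have hf : MDifferentiableAt 𝓘(ℝ, E) 𝓘(ℝ, E) (fun z => (φ.symm y)⁻¹ * φ.symm z) y :=
    MDifferentiableAt.comp (I' := 𝓘(ℝ, E)) y
      ((contMDiff_mulLeft (E := E) (φ.symm y)⁻¹).mdiffAt (φ.symm y)) hy'.mdiffAt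
  have hψ : MDifferentiableAt 𝓘(ℝ, E) 𝓘(ℝ, E) ψ ((φ.symm y)⁻¹ * φ.symm y) := by
    rw [inv_mul_cancel]
    exact (contMDiffAt_chart 1 (mem_extChartAt_source 1)).mdiffAt
  have h2 := tderiv_comp_apply (f := fun z => (φ.symm y)⁻¹ * φ.symm z) hψ hf v
  rw [tderiv_eq_fderiv, inv_mul_cancel, tderiv_chart] at h2
  exact h1.symm.trans h2.symm

end LieGroups

/-! ### The Lie bracket through the Maurer-Cartan form -/

section Bracket

variable {E : Type*} [NormedAddCommGroup E] [NormedSpace ℝ E] [CompleteSpace E]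
  {G : Type*} [TopologicalSpace G] [ChartedSpace E G] [Group G] [LieGroup 𝓘(ℝ, E) ∞ G]
  {E' : Type*} [NormedAddCommGroup E'] [NormedSpace ℝ E'] [CompleteSpace E']
  {G' : Type*} [TopologicalSpace G'] [ChartedSpace E' G'] [Group G'] [LieGroup 𝓘(ℝ, E') ∞ G']

open VectorField

theorem lieBracketCLM_eq_lieBracket (v w : E) :
    lieBracketCLM E G v w = lieBracket ℝ
      (mpullbackWithin 𝓘(ℝ, E) 𝓘(ℝ, E) (extChartAt 𝓘(ℝ, E) (1 : G)).symm
        (mulInvariantVectorField (I := 𝓘(ℝ, E)) (G := G) v) (range 𝓘(ℝ, E)))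
      (mpullbackWithin 𝓘(ℝ, E) 𝓘(ℝ, E) (extChartAt 𝓘(ℝ, E) (1 : G)).symm
        (mulInvariantVectorField (I := 𝓘(ℝ, E)) (G := G) w) (range 𝓘(ℝ, E)))
      (extChartAt 𝓘(ℝ, E) (1 : G) 1) := by
  refine (lieBracketCLM_apply (G := G) v w).trans ?_
  revert v w
  change ∀ v w : GroupLieAlgebra 𝓘(ℝ, E) G, ⁅v, w⁆ = _
  intro v w
  rw [GroupLieAlgebra.bracket_def, ← mlieBracketWithin_univ, mlieBracketWithin_apply]
  have hs : (extChartAt 𝓘(ℝ, E) (1 : G)).symm ⁻¹' univ ∩ range 𝓘(ℝ, E) = univ := by simp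
  rw [hs]
  have hid : ∀ z : E, (tderiv 𝓘(ℝ, E) 𝓘(ℝ, E) (extChartAt 𝓘(ℝ, E) (1 : G)) 1).inverse z = z := by
    intro z
    rw [tderiv_chart, ContinuousLinearMap.inverse_id]
    rfl
  refine (hid _).trans ?_
  exact congrFun (lieBracketWithin_univ (𝕜 := ℝ) (E := E)) _

theorem extDeriv_one_vectorField {F : Type*} [NormedAddCommGroup F] [NormedSpace ℝ F]
    {η : E → E [⋀^Fin 1]→L[ℝ] F} {V W : E → E} {x : E} (hη : DifferentiableAt ℝ η x)
    (hV : DifferentiableAt ℝ V x) (hW : DifferentiableAt ℝ W x) :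
    extDeriv η x ![V x, W x] = fderiv ℝ (fun y => η y ![W y]) x (V x) -
      fderiv ℝ (fun y => η y ![V y]) x (W x) - η x ![lieBracket ℝ V W x] := by
  have key := extDeriv_apply_vectorField (V := ![V, W]) hη (by
    intro i; fin_cases i
    · exact hV
    · exact hW)
  have e0 : (fun i => (![V, W] : Fin 2 → E → E) i x) = ![V x, W x] := by
    funext i; fin_cases i <;> rfl
  have e1 : ∀ y, (0 : Fin 2).removeNth (fun i => (![V, W] : Fin 2 → E → E) i y) = ![W y] := by
    intro y; funext i; fin_cases i; rfl
  have e2 : ∀ y, (1 : Fin 2).removeNth (fun i => (![V, W] : Fin 2 → E → E) i y) = ![V y] := by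
    intro y; funext i; fin_cases i; rfl
  have e4 : ∀ (z : E) (u : Fin 0 → E), (Matrix.vecCons z u : Fin 1 → E) = ![z] := by
    intro z u; funext i; fin_cases i; rfl
  rw [e0, Fin.sum_univ_two] at key
  simp only [e1, e2] at key
  rw [key]
  simp [e4, sub_eq_add_neg]

/-- The Maurer-Cartan equation at the neutral element. -/
theorem dForm_maurerCartan_one (v w : E) :
    dForm 𝓘(ℝ, E) (maurerCartan E G) 1 ![v, w] = -lieBracketCLM E G v w := by
  have : LieGroup 𝓘(ℝ, E) (minSmoothness ℝ 3) G := lieGroup_minSmoothness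
  let φ := extChartAt 𝓘(ℝ, E) (1 : G)
  let C : E → E → E := fun v => mpullbackWithin 𝓘(ℝ, E) 𝓘(ℝ, E) φ.symm
        (mulInvariantVectorField (I := 𝓘(ℝ, E)) (G := G) v) (range 𝓘(ℝ, E))
  have hs : φ.symm ⁻¹' univ ∩ range 𝓘(ℝ, E) = univ := by simp
  have hd : ∀ v : E, DifferentiableAt ℝ (C v) (φ 1) := by
    intro v
    have h := (mdifferentiableAt_mulInvariantVectorField (I := 𝓘(ℝ, E)) (G := G) v
      (g := 1)).mdifferentiableWithinAt (s := univ)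
    have h2 := MDifferentiableWithinAt.differentiableWithinAt_mpullbackWithin_vectorField h
    rw [hs] at h2
    exact differentiableWithinAt_univ.1 h2
  -- The Maurer-Cartan form is constant on left-invariant fields. In Cartan's formula for two such
  -- fields the derivative terms therefore vanish, and only the value on their bracket survives.
  have hC : ∀ v : E, ∀ y ∈ φ.target, formInChart 𝓘(ℝ, E) 1 (maurerCartan E G) y ![C v y] = v := by
    intro v y hy
    rw [formInChart_eq, pullback_one]
    have hinv : (mfderivWithin 𝓘(ℝ, E) 𝓘(ℝ, E) φ.symm (range 𝓘(ℝ, E)) y).IsInvertible :=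
      isInvertible_mfderivWithin_extChartAt_symm hy
    have h1 : tderiv 𝓘(ℝ, E) 𝓘(ℝ, E) φ.symm y (C v y) =
        mulInvariantVectorField (I := 𝓘(ℝ, E)) (G := G) v (φ.symm y) := by
      have h2 := hinv.self_apply_inverse
        (mulInvariantVectorField (I := 𝓘(ℝ, E)) (G := G) v (φ.symm y))
      refine Eq.trans ?_ h2
      have h3 : (tderiv 𝓘(ℝ, E) 𝓘(ℝ, E) φ.symm y : E →L[ℝ] E) =
          mfderivWithin 𝓘(ℝ, E) 𝓘(ℝ, E) φ.symm (range 𝓘(ℝ, E)) y := by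
        rw [ModelWithCorners.range_eq_univ, mfderivWithin_univ]; rfl
      rw [h3]
      rfl
    rw [h1]
    exact maurerCartan_mulLeft (φ.symm y) v
  have hCev : ∀ u v : E, fderiv ℝ (fun y => formInChart 𝓘(ℝ, E) 1 (maurerCartan E G) y ![C v y])
      (φ 1) u = 0 := by
    intro u v
    have h : (fun y => formInChart 𝓘(ℝ, E) 1 (maurerCartan E G) y ![C v y]) =ᶠ[𝓝 (φ 1)]
        fun _ => v := by
      filter_upwards [target_mem_nhds (I := 𝓘(ℝ, E)) (1 : G)] with y hy
      exact hC v y hy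
    rw [h.fderiv_eq]
    simp
  have hμ : ∀ z : E, formInChart 𝓘(ℝ, E) 1 (maurerCartan E G) (φ 1) ![z] = z := by
    intro z
    rw [formInChart_eq, pullback_one, tderiv_chart_symm, extChartAt_to_inv]
    exact maurerCartan_one z
  have hC1 : ∀ v : E, C v (φ 1) = v := by
    intro v
    rw [← hμ (C v (φ 1))]
    exact hC v _ (mem_extChartAt_target 1)
  have hω : DifferentiableAt ℝ (formInChart 𝓘(ℝ, E) 1 (maurerCartan E G)) (φ 1) :=
    ContDiffAt.differentiableAt (isSmoothForm_iff.1 isSmoothForm_maurerCartan 1) (by simp)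
  have key := extDeriv_one_vectorField hω (hd v) (hd w)
  rw [hCev, hCev, hC1, hC1, hμ] at key
  rw [dForm_eq, lieBracketCLM_eq_lieBracket]
  rw [sub_zero, zero_sub] at key
  exact key

/-- Up to sign the bracket is the value at 1 of the 2-form dμ, which is alternating. -/
theorem lieBracketCLM_skew (v w : E) : lieBracketCLM E G v w = -lieBracketCLM E G w v := by
  have h : (![w, v] : Fin 2 → E) = ![v, w] ∘ Equiv.swap 0 1 := by
    funext i; fin_cases i <;> rfl
  have h2 := (dForm 𝓘(ℝ, E) (maurerCartan E G) 1).toAlternatingMap.map_swap ![v, w]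
    (i := 0) (j := 1) (by decide)
  rw [← h] at h2
  have h3 : dForm 𝓘(ℝ, E) (maurerCartan E G) 1 ![w, v] =
    -dForm 𝓘(ℝ, E) (maurerCartan E G) 1 ![v, w] := h2
  rw [dForm_maurerCartan_one, dForm_maurerCartan_one, neg_neg] at h3
  exact h3.symm

/-- Take the exterior derivative of f^*μ' = f_* ∘ μ at 1 and use the Maurer-Cartan equation on both
sides. -/
theorem lieMap_lieBracketCLM {f : G →* G'} (hf : ContMDiff 𝓘(ℝ, E) 𝓘(ℝ, E') ∞ f) (v w : E) :
    lieMap (E := E) (E' := E') f (lieBracketCLM E G v w) =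
      lieBracketCLM E' G' (lieMap (E := E) (E' := E') f v) (lieMap (E := E) (E' := E') f w) := by
  have h1 := dForm_pullback (I := 𝓘(ℝ, E)) (x := (1 : G))
    (isSmoothForm_iff.1 (isSmoothForm_maurerCartan (E := E') (G := G')) (f 1)) hf.contMDiffAt
  rw [pullback_maurerCartan hf,
    dForm_mapForm _ (isSmoothForm_iff.1 isSmoothForm_maurerCartan 1)] at h1
  have h2 := congrArg (fun α : E [⋀^Fin 2]→L[ℝ] E' => α ![v, w]) h1
  simp only [pullback_two, map_one] at h2
  rw [ContinuousLinearMap.compContinuousAlternatingMap_coe, Function.comp_apply,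
    dForm_maurerCartan_one, ← lieMap_eq, dForm_maurerCartan_one, map_neg, neg_inj] at h2
  exact h2

theorem Ad_lieBracketCLM (g : G) (v w : E) :
    Ad g (lieBracketCLM E G v w) = lieBracketCLM E G (Ad g v) (Ad g w) :=
  lieMap_lieBracketCLM (contMDiff_conjHom g) v w

end Bracket

/-! ## Connections and their curvature -/

section Connections

variable {EP : Type*} [NormedAddCommGroup EP] [NormedSpace ℝ EP]
  {P : Type*} [TopologicalSpace P] [ChartedSpace EP P] [IsManifold 𝓘(ℝ, EP) ∞ P]
  {E : Type*} [NormedAddCommGroup E] [NormedSpace ℝ E]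
  {G : Type*} [TopologicalSpace G] [ChartedSpace E G] [Group G] [LieGroup 𝓘(ℝ, E) ∞ G]

/-- A smooth right action of a Lie group on a manifold. -/
structure IsSmoothAction (act : P → G → P) : Prop where
  smooth : ContMDiff (𝓘(ℝ, EP).prod 𝓘(ℝ, E)) 𝓘(ℝ, EP) ∞ (fun p : P × G => act p.1 p.2)
  act_one : ∀ p, act p 1 = p
  act_mul : ∀ p g h, act p (g * h) = act (act p g) h

theorem isSmoothAction_mul : IsSmoothAction (EP := E) (E := E) (fun g h : G => g * h) where
  smooth := contMDiff_mul 𝓘(ℝ, E) ∞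
  act_one := mul_one
  act_mul p g h := (mul_assoc p g h).symm

theorem fundamentalVector_eq (act : P → G → P) (Y : E) (p : P) :
    fundamentalVector (EP := EP) act Y p = tderiv 𝓘(ℝ, E) 𝓘(ℝ, EP) (act p) 1 Y := rfl

namespace IsSmoothAction

variable {act : P → G → P} (ha : IsSmoothAction (EP := EP) (E := E) act)
include ha

theorem contMDiff_right (g : G) : ContMDiff 𝓘(ℝ, EP) 𝓘(ℝ, EP) ∞ (fun p => act p g) :=
  ha.smooth.comp (contMDiff_id.prodMk contMDiff_const)

theorem contMDiff_left (p : P) : ContMDiff 𝓘(ℝ, E) 𝓘(ℝ, EP) ∞ (act p) :=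
  ha.smooth.comp (contMDiff_const.prodMk contMDiff_id)

/-- The orbit map satisfies p h = (p g)(g⁻¹ h), which moves the derivative at `g` to the neutral
element. -/
theorem tderiv_left (p : P) (g : G) (w : E) :
    tderiv 𝓘(ℝ, E) 𝓘(ℝ, EP) (act p) g w =
      fundamentalVector act (maurerCartan E G g ![w]) (act p g) := by
  have h := tderiv_comp_apply (g := act (act p g)) (f := fun h : G => g⁻¹ * h)
    ((ha.contMDiff_left (act p g)).mdiffAt (g⁻¹ * g))
    ((contMDiff_mulLeft (E := E) g⁻¹).mdiffAt g) w
  simp only [← ha.act_mul, mul_inv_cancel_left, inv_mul_cancel] at h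
  exact h

theorem tderiv_apply (p : P) (g : G) (v : EP) (w : E) :
    tderiv (𝓘(ℝ, EP).prod 𝓘(ℝ, E)) 𝓘(ℝ, EP) (fun z : P × G => act z.1 z.2) (p, g) (v, w) =
      tderiv 𝓘(ℝ, EP) 𝓘(ℝ, EP) (fun p => act p g) p v +
        fundamentalVector act (maurerCartan E G g ![w]) (act p g) := by
  rw [tderiv_prod_apply (ha.smooth.mdiffAt (p, g)), ← ha.tderiv_left]

end IsSmoothAction

namespace IsConnection

variable {act : P → G → P} (ha : IsSmoothAction (EP := EP) (E := E) act) {θ : DForm EP P 1 E}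
  (hθ : IsConnection act θ)
include hθ

theorem apply_right (p : P) (g : G) (v : EP) :
    θ (act p g) ![tderiv 𝓘(ℝ, EP) 𝓘(ℝ, EP) (fun p => act p g) p v] = Ad g⁻¹ (θ p ![v]) := by
  have h := congrArg (fun α : EP [⋀^Fin 1]→L[ℝ] E => α ![v]) (congrFun (hθ.equivariant g) p)
  rw [pullback_one] at h
  exact h

include ha

/-- A tangent vector of `P × G` splits into two parts: the one along `P` is right translated, where
equivariance applies, and the one along `G` becomes a fundamental vector. This drives the comparison
with the gerbe connection. -/
theorem apply_tderiv (p : P) (g : G) (v : EP) (w : E) :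
    θ (act p g) ![tderiv (𝓘(ℝ, EP).prod 𝓘(ℝ, E)) 𝓘(ℝ, EP) (fun z : P × G => act z.1 z.2) (p, g)
      (v, w)] = Ad g⁻¹ (θ p ![v]) + maurerCartan E G g ![w] := by
  rw [ha.tderiv_apply, ← oneForm_apply, map_add, oneForm_apply, oneForm_apply, hθ.apply_right,
    hθ.fundamental]

/-- The exterior derivative of a connection on a fundamental vector is given by the infinitesimal
adjoint action. -/
theorem dForm_fundamentalVector_eq_fderiv (p : P) (Y : E) (W : EP) :
    dForm 𝓘(ℝ, EP) θ p ![fundamentalVector act Y p, W] =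
      fderiv ℝ (fun h => Ad ((extChartAt 𝓘(ℝ, E) (1 : G)).symm h)⁻¹ (θ p ![W]))
        (extChartAt 𝓘(ℝ, E) (1 : G) 1) Y := by
  let φ := extChartAt 𝓘(ℝ, EP) p
  let ψ := extChartAt 𝓘(ℝ, E) (1 : G)
  -- The action in charts, a map from a vector space. On it the constant fields (0, Y) and (W, 0)
  -- replace extensions of the two given tangent vectors, and dθ is found from the coordinate
  -- formula for the pull-back `β`.
  let Ψ : EP × E → P := fun z => act (φ.symm z.1) (ψ.symm z.2)
  have hΨ : ∀ y ∈ φ.target, ∀ h ∈ ψ.target, ContMDiffAt 𝓘(ℝ, EP × E) 𝓘(ℝ, EP) ∞ Ψ (y, h) := by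
    intro y hy h hh
    have h1 : ContMDiffAt 𝓘(ℝ, EP × E) 𝓘(ℝ, EP) ∞ (fun z : EP × E => φ.symm z.1) (y, h) :=
      ContMDiffAt.comp (g := φ.symm) (f := Prod.fst) (I' := 𝓘(ℝ, EP)) (y, h)
        (contMDiffAt_chart_symm p hy) contDiff_fst.contMDiff.contMDiffAt
    have h2 : ContMDiffAt 𝓘(ℝ, EP × E) 𝓘(ℝ, E) ∞ (fun z : EP × E => ψ.symm z.2) (y, h) :=
      ContMDiffAt.comp (g := ψ.symm) (f := Prod.snd) (I' := 𝓘(ℝ, E)) (y, h)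
        (contMDiffAt_chart_symm 1 hh) contDiff_snd.contMDiff.contMDiffAt
    exact ContMDiffAt.comp (g := fun z : P × G => act z.1 z.2)
      (f := fun z : EP × E => (φ.symm z.1, ψ.symm z.2)) (I' := 𝓘(ℝ, EP).prod 𝓘(ℝ, E)) (y, h)
      ha.smooth.contMDiffAt (h1.prodMk h2)
  have hφp : φ p ∈ φ.target := mem_extChartAt_target p
  have hψ1 : ψ 1 ∈ ψ.target := mem_extChartAt_target 1
  have hφs : φ.symm (φ p) = p := extChartAt_to_inv p
  have hψs : ψ.symm (ψ 1) = 1 := extChartAt_to_inv 1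
  let z0 : EP × E := (φ p, ψ 1)
  have hΨ0 : Ψ z0 = p := by
    change act (φ.symm (φ p)) (ψ.symm (ψ 1)) = p
    rw [hφs, hψs, ha.act_one]
  let β := pullback 𝓘(ℝ, EP × E) 𝓘(ℝ, EP) Ψ θ
  have hθp := isSmoothForm_iff.1 hθ.smooth
  have hβs : SmoothFormAt 𝓘(ℝ, EP × E) β z0 := (hθp (Ψ z0)).pullback (hΨ _ hφp _ hψ1)
  have hβ : DifferentiableAt ℝ β z0 := (smoothFormAt_vectorSpace.1 hβs).differentiableAt (by simp)
  -- the partial derivatives of `Ψ`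
  have hinl : ∀ y ∈ φ.target, ∀ h ∈ ψ.target, ∀ w : EP,
      tderiv 𝓘(ℝ, EP × E) 𝓘(ℝ, EP) Ψ (y, h) (w, 0) =
        tderiv 𝓘(ℝ, EP) 𝓘(ℝ, EP) (fun y => act (φ.symm y) (ψ.symm h)) y w := by
    intro y hy h hh w
    have hj : HasFDerivAt (fun y : EP => (y, h)) (ContinuousLinearMap.inl ℝ EP E) y :=
      hasFDerivAt_prodMk_left y h
    have e := tderiv_comp_apply (I := 𝓘(ℝ, EP)) (g := Ψ) (f := fun y : EP => (y, h)) (x := y)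
      (hΨ y hy h hh).mdiffAt hj.differentiableAt.mdifferentiableAt w
    rw [tderiv_eq_fderiv, hj.fderiv] at e
    exact e.symm
  have hinr : ∀ y ∈ φ.target, ∀ h ∈ ψ.target, ∀ w : E,
      tderiv 𝓘(ℝ, EP × E) 𝓘(ℝ, EP) Ψ (y, h) (0, w) =
        tderiv 𝓘(ℝ, E) 𝓘(ℝ, EP) (fun h => act (φ.symm y) (ψ.symm h)) h w := by
    intro y hy h hh w
    have hj : HasFDerivAt (fun h : E => (y, h)) (ContinuousLinearMap.inr ℝ EP E) h :=
      hasFDerivAt_prodMk_right y h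
    have e := tderiv_comp_apply (I := 𝓘(ℝ, E)) (g := Ψ) (f := fun h : E => (y, h)) (x := h)
      (hΨ y hy h hh).mdiffAt hj.differentiableAt.mdifferentiableAt w
    rw [tderiv_eq_fderiv, hj.fderiv] at e
    exact e.symm
  have hinl' : ∀ h ∈ ψ.target, ∀ w : EP, tderiv 𝓘(ℝ, EP × E) 𝓘(ℝ, EP) Ψ (φ p, h) (w, 0) =
      tderiv 𝓘(ℝ, EP) 𝓘(ℝ, EP) (fun p => act p (ψ.symm h)) p w := by
    intro h hh w
    rw [hinl _ hφp h hh]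
    have e := tderiv_comp_apply (g := fun p => act p (ψ.symm h)) (f := φ.symm) (x := φ p)
      ((ha.contMDiff_right (ψ.symm h)).mdiffAt _) (contMDiffAt_chart_symm p hφp).mdiffAt w
    rw [hφs, tderiv_chart_symm] at e
    exact e
  have hinr' : ∀ y ∈ φ.target, ∀ w : E, tderiv 𝓘(ℝ, EP × E) 𝓘(ℝ, EP) Ψ (y, ψ 1) (0, w) =
      fundamentalVector act w (φ.symm y) := by
    intro y hy w
    rw [hinr y hy _ hψ1]
    have e := tderiv_comp_apply (g := act (φ.symm y)) (f := ψ.symm) (x := ψ 1)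
      ((ha.contMDiff_left (φ.symm y)).mdiffAt _) (contMDiffAt_chart_symm 1 hψ1).mdiffAt w
    rw [hψs, tderiv_chart_symm] at e
    exact e
  have key := dForm_pullback (I := 𝓘(ℝ, EP × E)) (hθp (Ψ z0)) (hΨ _ hφp _ hψ1)
  rw [dForm_vectorSpace] at key
  have key2 := congrArg (fun α : (EP × E) [⋀^Fin 2]→L[ℝ] E => α ![((0 : EP), Y), (W, (0 : E))]) key
  simp only [pullback_two] at key2
  rw [hΨ0, show z0 = (φ p, ψ 1) from rfl, hinr' _ hφp, hinl' _ hψ1, hφs, hψs] at key2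
  have hact1 : (fun p => act p 1) = fun p => p := funext ha.act_one
  rw [hact1, tderiv_id] at key2
  refine key2.symm.trans ?_
  rw [show ((φ p, ψ 1) : EP × E) = z0 from rfl]
  refine (extDeriv_one_apply hβ _ _).trans ?_
  have hev : ∀ u : EP × E, DifferentiableAt ℝ (fun z => β z ![u]) z0 := by
    intro u
    exact hβ.continuousAlternatingMap_apply_const _
  -- A derivative along (0, Y) sees only the slice through `φ p`, on which equivariance evaluates
  -- `β` on (W, 0).
  have h1 : fderiv ℝ (fun z => β z ![(W, (0 : E))]) z0 ((0 : EP), Y) =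
      fderiv ℝ (fun h => Ad (ψ.symm h)⁻¹ (θ p ![W])) (ψ 1) Y := by
    have hj : HasFDerivAt (fun h : E => (φ p, h)) (ContinuousLinearMap.inr ℝ EP E) (ψ 1) :=
      hasFDerivAt_prodMk_right (φ p) (ψ 1)
    have e := ((hev (W, 0)).hasFDerivAt.comp (ψ 1) hj).fderiv
    have e2 : ((fun z => β z ![(W, (0 : E))]) ∘ fun h : E => (φ p, h)) =ᶠ[𝓝 (ψ 1)]
        fun h => Ad (ψ.symm h)⁻¹ (θ p ![W]) := by
      filter_upwards [target_mem_nhds (I := 𝓘(ℝ, E)) (1 : G)] with h hh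
      simp only [Function.comp_apply, β, pullback_one]
      rw [hinl' h hh, ← hθ.apply_right p (ψ.symm h) W]
      change θ (act (φ.symm (φ p)) (ψ.symm h)) _ = _
      rw [hφs]
    rw [e2.fderiv_eq] at e
    rw [e]
    rfl
  -- On the slice through `ψ 1` the field (0, Y) maps to fundamental vectors, so `β` takes the
  -- constant value `Y` on it.
  have h2 : fderiv ℝ (fun z => β z ![((0 : EP), Y)]) z0 (W, (0 : E)) = 0 := by
    have hj : HasFDerivAt (fun y : EP => (y, ψ 1)) (ContinuousLinearMap.inl ℝ EP E) (φ p) :=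
      hasFDerivAt_prodMk_left (φ p) (ψ 1)
    have e := ((hev (0, Y)).hasFDerivAt.comp (φ p) hj).fderiv
    have e2 : ((fun z => β z ![((0 : EP), Y)]) ∘ fun y : EP => (y, ψ 1)) =ᶠ[𝓝 (φ p)]
        fun _ => Y := by
      filter_upwards [target_mem_nhds (I := 𝓘(ℝ, EP)) p] with y hy
      simp only [Function.comp_apply, β, pullback_one]
      rw [hinr' y hy]
      change θ (act (φ.symm y) (ψ.symm (ψ 1))) _ = _
      rw [hψs, ha.act_one, hθ.fundamental]
    rw [e2.fderiv_eq] at e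
    have e3 := congrArg (fun A : EP →L[ℝ] E => A W) e
    simpa using e3.symm
  rw [h1, h2, sub_zero]

end IsConnection

/-- The group acting on itself from the right, as a bundle over a point. This is the test case from
which the derivative of `Ad` is read off. -/
theorem isConnection_maurerCartan :
    IsConnection (fun g h : G => g * h) (maurerCartan E G) where
  smooth := isSmoothForm_maurerCartan
  fundamental g Y := maurerCartan_mulLeft g Y
  equivariant g := pullback_mulRight_maurerCartan g

end Connections

/-! ### Curvature: horizontality, equivariance and the abelian case -/

section Curvature

variable {EP : Type*} [NormedAddCommGroup EP] [NormedSpace ℝ EP]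
  {P : Type*} [TopologicalSpace P] [ChartedSpace EP P] [IsManifold 𝓘(ℝ, EP) ∞ P]
  {E : Type*} [NormedAddCommGroup E] [NormedSpace ℝ E] [CompleteSpace E]
  {G : Type*} [TopologicalSpace G] [ChartedSpace E G] [Group G] [LieGroup 𝓘(ℝ, E) ∞ G]

/-- The derivative of the adjoint action at the neutral element is the Lie bracket. -/
theorem fderiv_Ad_inv (Y Z : E) :
    fderiv ℝ (fun h => Ad ((extChartAt 𝓘(ℝ, E) (1 : G)).symm h)⁻¹ Z)
      (extChartAt 𝓘(ℝ, E) (1 : G) 1) Y = -lieBracketCLM E G Y Z := by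
  -- For the Maurer-Cartan form the exterior derivative in this formula is already known from the
  -- Maurer-Cartan equation.
  have h := isConnection_maurerCartan.dForm_fundamentalVector_eq_fderiv
    (isSmoothAction_mul (E := E) (G := G)) 1 Y Z
  rw [maurerCartan_one] at h
  rw [← h, ← dForm_maurerCartan_one]
  congr 2
  rw [fundamentalVector_eq]
  simp only [one_mul, tderiv_id]
  rfl

/-- The bracket is the derivative of a constant function. This covers both the commutative group 𝕋
and the central line of Lie G'. -/
theorem lieBracketCLM_eq_zero_of_Ad {Z : E} (hZ : ∀ g : G, Ad g Z = Z) (Y : E) :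
    lieBracketCLM E G Y Z = 0 := by
  have h := fderiv_Ad_inv (G := G) Y Z
  simp only [hZ] at h
  simpa using h.symm

theorem IsConnection.dForm_fundamentalVector {act : P → G → P}
    (ha : IsSmoothAction (EP := EP) (E := E) act) {θ : DForm EP P 1 E} (hθ : IsConnection act θ)
    (p : P) (Y : E) (W : EP) :
    dForm 𝓘(ℝ, EP) θ p ![fundamentalVector act Y p, W] = -lieBracketCLM E G Y (θ p ![W]) := by
  rw [hθ.dForm_fundamentalVector_eq_fderiv ha, fderiv_Ad_inv]

/-- In the convention of `wedge`, [θ, θ](v, w) is twice [θ v, θ w] by skew symmetry, so the factor ½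
disappears. -/
theorem curvature_apply {H : Type*} [TopologicalSpace H] {I : ModelWithCorners ℝ EP H}
    {P : Type*} [TopologicalSpace P] [ChartedSpace H P] (θ : DForm EP P 1 E) (p : P) (v w : EP) :
    curvature I G θ p ![v, w] =
      dForm I θ p ![v, w] + lieBracketCLM E G (θ p ![v]) (θ p ![w]) := by
  have h : curvature I G θ p ![v, w] = dForm I θ p ![v, w] +
    (1 / 2 : ℝ) • wedge (lieBracketCLM E G) θ θ p ![v, w] := rfl
  rw [h, wedge_apply, lieBracketCLM_skew (θ p ![w]), sub_neg_eq_add, smul_add, ← add_smul,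
    add_halves, one_smul]

/-- The infinitesimal equivariance of θ gives dθ the value -[Y, θ W], which the bracket term
cancels. -/
theorem IsConnection.curvature_horizontal {act : P → G → P}
    (ha : IsSmoothAction (EP := EP) (E := E) act) {θ : DForm EP P 1 E} (hθ : IsConnection act θ)
    (p : P) (Y : E) (W : EP) :
    curvature 𝓘(ℝ, EP) G θ p ![fundamentalVector act Y p, W] = 0 := by
  rw [curvature_apply, hθ.dForm_fundamentalVector ha, hθ.fundamental, neg_add_cancel]

theorem IsConnection.dForm_right {act : P → G → P}
    (ha : IsSmoothAction (EP := EP) (E := E) act) {θ : DForm EP P 1 E} (hθ : IsConnection act θ)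
    (p : P) (g : G) (v w : EP) :
    dForm 𝓘(ℝ, EP) θ (act p g) ![tderiv 𝓘(ℝ, EP) 𝓘(ℝ, EP) (fun p => act p g) p v,
      tderiv 𝓘(ℝ, EP) 𝓘(ℝ, EP) (fun p => act p g) p w] =
      Ad g⁻¹ (dForm 𝓘(ℝ, EP) θ p ![v, w]) := by
  have hs := isSmoothForm_iff.1 hθ.smooth
  have h1 := dForm_pullback (I := 𝓘(ℝ, EP)) (I' := 𝓘(ℝ, EP)) (f := fun p => act p g) (η := θ)
    (x := p) (hs (act p g)) (ha.contMDiff_right g).contMDiffAt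
  rw [hθ.equivariant, dForm_mapForm _ (hs p)] at h1
  have h2 := DFunLike.congr_fun h1 ![v, w]
  rw [pullback_two] at h2
  exact h2.symm

theorem IsConnection.curvature_right {act : P → G → P}
    (ha : IsSmoothAction (EP := EP) (E := E) act) {θ : DForm EP P 1 E} (hθ : IsConnection act θ)
    (p : P) (g : G) (v w : EP) :
    curvature 𝓘(ℝ, EP) G θ (act p g) ![tderiv 𝓘(ℝ, EP) 𝓘(ℝ, EP) (fun p => act p g) p v,
      tderiv 𝓘(ℝ, EP) 𝓘(ℝ, EP) (fun p => act p g) p w] =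
      Ad g⁻¹ (curvature 𝓘(ℝ, EP) G θ p ![v, w]) := by
  rw [curvature_apply, curvature_apply, hθ.apply_right, hθ.apply_right, hθ.dForm_right ha,
    map_add, Ad_lieBracketCLM]

theorem isSmoothForm_curvature {θ : DForm EP P 1 E} (hθ : IsSmoothForm 𝓘(ℝ, EP) θ) :
    IsSmoothForm 𝓘(ℝ, EP) (curvature 𝓘(ℝ, EP) G θ) :=
  isSmoothForm_iff.2 fun p => (isSmoothForm_iff.1 hθ.dForm p).add
    (((isSmoothForm_iff.1 hθ p).wedge _ (isSmoothForm_iff.1 hθ p)).const_smul _)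

theorem lieBracketCLM_circle (v w : LieT) : lieBracketCLM LieT Circle v w = 0 :=
  lieBracketCLM_eq_zero_of_Ad (fun g => by
    rw [Ad_of_mem_center (E := LieT) (Subgroup.mem_center_iff.2 fun h => mul_comm h g)]
    rfl) v

theorem curvature_circle {H : Type*} [TopologicalSpace H] {I : ModelWithCorners ℝ EP H}
    {P : Type*} [TopologicalSpace P] [ChartedSpace H P] (N : DForm EP P 1 LieT) :
    curvature I Circle N = dForm I N := by
  funext p
  refine form_two_ext fun v w => ?_
  rw [curvature_apply, lieBracketCLM_circle, add_zero]

end Curvature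

/-! ## Surjective submersions and the descent of forms -/

section Submersions

variable {E : Type*} [NormedAddCommGroup E] [NormedSpace ℝ E]
  {H : Type*} [TopologicalSpace H] {I : ModelWithCorners ℝ E H} [I.Boundaryless]
  {P : Type*} [TopologicalSpace P] [ChartedSpace H P] [IsManifold I ∞ P]
  {E' : Type*} [NormedAddCommGroup E'] [NormedSpace ℝ E']
  {H' : Type*} [TopologicalSpace H'] {I' : ModelWithCorners ℝ E' H'} [I'.Boundaryless]
  {X : Type*} [TopologicalSpace X] [ChartedSpace H' X] [IsManifold I' ∞ X]
  {F : Type*} [NormedAddCommGroup F] [NormedSpace ℝ F]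
  {k : ℕ}

variable (I I') in
/-- A surjective smooth map which has a smooth local section through every point. -/
structure HasLocalSections (π : P → X) : Prop where
  smooth : ContMDiff I I' ∞ π
  surjective : Function.Surjective π
  exists_section : ∀ p, ∃ (U : Set X) (s : X → P), IsOpen U ∧ π p ∈ U ∧ ContMDiffOn I' I ∞ s U ∧
    s (π p) = p ∧ ∀ x ∈ U, π (s x) = x

namespace HasLocalSections

variable {π : P → X} (h : HasLocalSections I I' π)
include h

theorem tderiv_surjective (p : P) : Function.Surjective (tderiv I I' π p) := by
  obtain ⟨U, s, hU, hp, hs, hsp, hπs⟩ := h.exists_section p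
  intro v
  have h1 := tderiv_comp_apply (g := π) (f := s) (x := π p) (h.smooth.mdiffAt _)
    (hs.contMDiffAt (hU.mem_nhds hp)).mdiffAt v
  rw [tderiv_congr (g := fun x => x) (by filter_upwards [hU.mem_nhds hp] with x hx using hπs x hx),
    tderiv_id, hsp] at h1
  exact ⟨_, h1.symm⟩

/-- Points and tangent vectors of `X` all lift to `P`. Every identity of forms on a base is proved
below by passing upstairs through this lemma. -/
theorem pullback_injective {η η' : DForm E' X k F} (hη : pullback I I' π η = pullback I I' π η') :
    η = η' := by
  funext x
  obtain ⟨p, rfl⟩ := h.surjective x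
  ext v
  choose w hw using fun i => h.tderiv_surjective p (v i)
  have h1 := DFunLike.congr_fun (congrFun hη p) w
  have hv : v = fun i => tderiv I I' π p (w i) := funext fun i => (hw i).symm
  rw [hv]
  exact h1

theorem eventuallyEq_pullback_section {U : Set X} {s : X → P} (hU : IsOpen U)
    (hs : ContMDiffOn I' I ∞ s U) (hπs : ∀ x ∈ U, π (s x) = x) {x : X} (hx : x ∈ U)
    (η : DForm E' X k F) : η =ᶠ[𝓝 x] pullback I' I s (pullback I I' π η) := by
  filter_upwards [hU.mem_nhds hx] with y hy
  rw [← pullback_comp (h.smooth.mdiffAt _) (hs.contMDiffAt (hU.mem_nhds hy)).mdiffAt,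
    pullback_congr (g := fun x => x)
      (by filter_upwards [hU.mem_nhds hy] with z hz using hπs z hz), pullback_id]

/-- Near each point the form is recovered by pulling its pull-back along a smooth local section. -/
theorem isSmoothForm_of_pullback {η : DForm E' X k F} (hη : IsSmoothForm I (pullback I I' π η)) :
    IsSmoothForm I' η := by
  refine isSmoothForm_iff.2 fun x => ?_
  obtain ⟨p, rfl⟩ := h.surjective x
  obtain ⟨U, s, hU, hp, hs, hsp, hπs⟩ := h.exists_section p
  exact ((isSmoothForm_iff.1 hη _).pullback (hs.contMDiffAt (hU.mem_nhds hp))).congr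
    (h.eventuallyEq_pullback_section hU hs hπs hp η)

/-- A smooth form whose values depend only on the projections of the base point and of the
tangent vectors descends. -/
theorem existsUnique_descend {η : DForm E P k F} (hη : IsSmoothForm I η)
    (hb : ∀ p p', π p = π p' → ∀ v v' : Fin k → E,
      (∀ i, tderiv I I' π p (v i) = tderiv I I' π p' (v' i)) → η p v = η p' v') :
    ∃! κ : DForm E' X k F, IsSmoothForm I' κ ∧ pullback I I' π κ = η := by
  choose σ hσ using h.surjective
  choose U s hU hp hs hsp hπs using fun x => h.exists_section (σ x)
  -- The section used at `x` is chosen independently for each `x`, so smoothness of `κ` is not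
  -- visible here. Basicness of `η` makes the choices irrelevant, and smoothness follows once the
  -- pull-back is known to be `η`.
  let κ : DForm E' X k F := fun x =>
    (η (σ x)).compContinuousLinearMap (tderiv I' I (s x) x)
  have hpull : pullback I I' π κ = η := by
    funext p
    ext v
    change η (σ (π p)) (fun i => tderiv I' I (s (π p)) (π p) (tderiv I I' π p (v i))) = η p v
    refine hb _ _ (hσ _) _ _ fun i => ?_
    have hmem : π p ∈ U (π p) := by simpa [hσ] using hp (π p)
    have hsp' : s (π p) (π p) = σ (π p) := by simpa [hσ] using hsp (π p)
    have h1 := tderiv_comp_apply (g := π) (f := s (π p)) (x := π p) (h.smooth.mdiffAt _)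
      ((hs (π p)).contMDiffAt ((hU _).mem_nhds hmem)).mdiffAt (tderiv I I' π p (v i))
    rw [tderiv_congr (g := fun x => x)
      (by filter_upwards [(hU _).mem_nhds hmem] with x hx using hπs _ x hx), tderiv_id, hsp'] at h1
    exact h1.symm
  exact ⟨κ, ⟨h.isSmoothForm_of_pullback (hpull ▸ hη), hpull⟩,
    fun κ' hκ' => h.pullback_injective (hκ'.2.trans hpull.symm)⟩

end HasLocalSections

theorem form_two_swap (α : E [⋀^Fin 2]→L[ℝ] F) (v w : E) : α ![v, w] = -α ![w, v] := by
  have h1 : (![v, w] : Fin 2 → E) = ![w, v] ∘ Equiv.swap 0 1 := by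
    funext i; fin_cases i <;> rfl
  rw [h1]
  exact α.toAlternatingMap.map_swap ![w, v] (i := 0) (j := 1) (by decide)

theorem form_two_add_left (α : E [⋀^Fin 2]→L[ℝ] F) (u v w : E) :
    α ![u + v, w] = α ![u, w] + α ![v, w] :=
  α.toAlternatingMap.map_vecCons_add ![w] u v

theorem form_two_add_right (α : E [⋀^Fin 2]→L[ℝ] F) (u v w : E) :
    α ![w, u + v] = α ![w, u] + α ![w, v] := by
  rw [form_two_swap, form_two_add_left, neg_add, ← form_two_swap, ← form_two_swap]

end Submersions

/-! ## Principal bundles -/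

section PrincipalBundles

variable {EX : Type*} [NormedAddCommGroup EX] [NormedSpace ℝ EX]
  {X : Type*} [TopologicalSpace X] [ChartedSpace EX X] [IsManifold 𝓘(ℝ, EX) ∞ X]
  {EP : Type*} [NormedAddCommGroup EP] [NormedSpace ℝ EP]
  {P : Type*} [TopologicalSpace P] [ChartedSpace EP P] [IsManifold 𝓘(ℝ, EP) ∞ P]
  {E : Type*} [NormedAddCommGroup E] [NormedSpace ℝ E]
  {G : Type*} [TopologicalSpace G] [ChartedSpace E G] [Group G] [LieGroup 𝓘(ℝ, E) ∞ G]
  {F : Type*} [NormedAddCommGroup F] [NormedSpace ℝ F]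

namespace IsPrincipalBundle

variable {π : P → X} {act : P → G → P}
  (h : IsPrincipalBundle (EX := EX) (EP := EP) (E := E) π act)
include h

theorem isSmoothAction : IsSmoothAction (EP := EP) (E := E) act :=
  ⟨h.smooth_act, h.act_one, h.act_mul⟩

theorem surjective : Function.Surjective π := by
  intro x
  obtain ⟨e, hx, -⟩ := h.locally_trivial x
  exact ⟨e.toOpenPartialHomeomorph.symm (x, 1), e.proj_symm_apply' hx⟩

theorem hasLocalSections : HasLocalSections 𝓘(ℝ, EP) 𝓘(ℝ, EX) π where
  smooth := h.smooth_proj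
  surjective := h.surjective
  exists_section p := by
    obtain ⟨e, hx, -, hsymm, -⟩ := h.locally_trivial (π p)
    refine ⟨e.baseSet, fun x => e.toOpenPartialHomeomorph.symm (x, (e p).2), e.open_baseSet, hx,
      ?_, ?_, fun x hx => e.proj_symm_apply' hx⟩
    · refine hsymm.comp (contMDiff_id.prodMk contMDiff_const).contMDiffOn fun x hx => ?_
      rw [e.target_eq]
      exact ⟨hx, mem_univ _⟩
    · have hp : p ∈ e.source := e.mem_source.2 hx
      rw [← e.coe_fst hp]
      exact e.left_inv hp

theorem exists_act_eq {p p' : P} (hp : π p = π p') : ∃ g, p' = act p g := by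
  obtain ⟨e, hx, -, -, he⟩ := h.locally_trivial (π p)
  have hps : p ∈ e.source := e.mem_source.2 hx
  have hps' : p' ∈ e.source := e.mem_source.2 (hp ▸ hx)
  refine ⟨(e p).2⁻¹ * (e p').2, ?_⟩
  have hact : act p ((e p).2⁻¹ * (e p').2) ∈ e.source :=
    e.mem_source.2 (by rw [h.proj_act]; exact hx)
  have heq : e p' = e (act p ((e p).2⁻¹ * (e p').2)) := by
    refine Prod.ext ?_ ?_
    · rw [e.coe_fst hps', e.coe_fst hact, h.proj_act, hp]
    · rw [he p hps, mul_inv_cancel_left]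
  exact e.injOn hps' hact heq

theorem tderiv_proj_right (p : P) (g : G) (v : EP) :
    tderiv 𝓘(ℝ, EP) 𝓘(ℝ, EX) π (act p g) (tderiv 𝓘(ℝ, EP) 𝓘(ℝ, EP) (fun p => act p g) p v) =
      tderiv 𝓘(ℝ, EP) 𝓘(ℝ, EX) π p v := by
  have h1 := tderiv_comp_apply (g := π) (f := fun p => act p g) (x := p) (h.smooth_proj.mdiffAt _)
    ((h.isSmoothAction.contMDiff_right g).mdiffAt p) v
  simp only [h.proj_act] at h1
  exact h1.symm

/-- The derivative of a local trivialization on a fundamental vector. -/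
theorem exists_tderiv_trivialization (p : P) : ∃ e : P → X × G, ∃ e' : X × G → P, ∃ a : G,
    (∀ v, tderiv (𝓘(ℝ, EX).prod 𝓘(ℝ, E)) 𝓘(ℝ, EP) e' (e p)
      (tderiv 𝓘(ℝ, EP) (𝓘(ℝ, EX).prod 𝓘(ℝ, E)) e p v) = v) ∧
    (∀ v, (tderiv 𝓘(ℝ, EP) (𝓘(ℝ, EX).prod 𝓘(ℝ, E)) e p v).1 = tderiv 𝓘(ℝ, EP) 𝓘(ℝ, EX) π p v) ∧
    ∀ Y, tderiv 𝓘(ℝ, EP) (𝓘(ℝ, EX).prod 𝓘(ℝ, E)) e p (fundamentalVector act Y p) =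
      (0, tderiv 𝓘(ℝ, E) 𝓘(ℝ, E) (fun g : G => a * g) 1 Y) := by
  obtain ⟨e, hx, hsm, hsymm, he⟩ := h.locally_trivial (π p)
  have hp : p ∈ e.source := e.mem_source.2 hx
  have hnhds : e.source ∈ 𝓝 p := e.open_source.mem_nhds hp
  have hed := (hsm.contMDiffAt hnhds).mdiffAt
  have hed' := (hsymm.contMDiffAt (e.open_target.mem_nhds (e.map_source hp))).mdiffAt
  refine ⟨e, e.toOpenPartialHomeomorph.symm, (e p).2, fun v => ?_, fun v => ?_, fun Y => ?_⟩
  · have h1 := tderiv_comp_apply (g := e.toOpenPartialHomeomorph.symm) (f := e) (x := p) hed' hed v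
    rw [tderiv_congr (g := fun p => p)
      (by filter_upwards [hnhds] with q hq using e.left_inv hq), tderiv_id] at h1
    exact h1.symm
  · have h1 := tderiv_comp_apply (g := (Prod.fst : X × G → X)) (f := e) (x := p)
      (I'' := 𝓘(ℝ, EX)) mdifferentiableAt_fst hed v
    rw [tderiv_congr (g := π)
      (by filter_upwards [hnhds] with q hq using e.coe_fst hq), tderiv_fst] at h1
    exact h1.symm
  · have hp1 : act p 1 = p := h.act_one p
    have h1 := tderiv_comp_apply (g := e) (f := act p) (x := (1 : G)) (by rw [hp1]; exact hed)
      ((h.isSmoothAction.contMDiff_left p).mdiffAt 1) Y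
    have h2 : (fun g => e (act p g)) = fun g => (π p, (e p).2 * g) := by
      funext g
      have hg : act p g ∈ e.source := e.mem_source.2 (by rw [h.proj_act]; exact hx)
      exact Prod.ext ((e.coe_fst hg).trans (h.proj_act p g)) (he p hp g)
    rw [h2, tderiv_prodMk mdifferentiableAt_const ((contMDiff_mulLeft (E := E) (e p).2).mdiffAt 1),
      tderiv_const, hp1] at h1
    exact h1.symm

/-- In a trivialization a vertical vector has only a group component, and left translation to 1
turns this component into the required element of the Lie algebra. -/
theorem exists_fundamentalVector_eq {p : P} {v : EP} (hv : tderiv 𝓘(ℝ, EP) 𝓘(ℝ, EX) π p v = 0) :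
    ∃ Y : E, fundamentalVector act Y p = v := by
  obtain ⟨e, e', a, h1, h2, h3⟩ := h.exists_tderiv_trivialization p
  refine ⟨maurerCartan E G a ![(tderiv 𝓘(ℝ, EP) (𝓘(ℝ, EX).prod 𝓘(ℝ, E)) e p v).2], ?_⟩
  rw [← h1 (fundamentalVector act _ p), h3, mulLeft_maurerCartan, ← hv, ← h2, Prod.mk.eta, h1]

theorem fundamentalVector_injective (p : P) :
    Function.Injective fun Y : E => (fundamentalVector act Y p : EP) := by
  obtain ⟨e, e', a, h1, h2, h3⟩ := h.exists_tderiv_trivialization p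
  intro Y Z hYZ
  have h4 := congrArg (fun v => (tderiv 𝓘(ℝ, EP) (𝓘(ℝ, EX).prod 𝓘(ℝ, E)) e p v).2) hYZ
  simp only [h3] at h4
  rw [← maurerCartan_mulLeft a Y, h4, maurerCartan_mulLeft]

/-- Horizontal invariant `2`-forms on a principal bundle descend to the base. -/
theorem existsUnique_descend_two {η : DForm EP P 2 F} (hη : IsSmoothForm 𝓘(ℝ, EP) η)
    (hh : ∀ p (Y : E) W, η p ![fundamentalVector act Y p, W] = 0)
    (hi : ∀ p g v w, η (act p g) ![tderiv 𝓘(ℝ, EP) 𝓘(ℝ, EP) (fun p => act p g) p v,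
      tderiv 𝓘(ℝ, EP) 𝓘(ℝ, EP) (fun p => act p g) p w] = η p ![v, w]) :
    ∃! κ : DForm EX X 2 F, IsSmoothForm 𝓘(ℝ, EX) κ ∧ pullback 𝓘(ℝ, EP) 𝓘(ℝ, EX) π κ = η := by
  refine h.hasLocalSections.existsUnique_descend hη fun p p' hp v v' hv => ?_
  obtain ⟨g, rfl⟩ := h.exists_act_eq hp
  -- Tangent vectors with the same projection differ, after right translation by `g`, by a vertical
  -- and hence fundamental vector; horizontality removes it.
  have hY : ∀ i, ∃ Y : E, v' i = fundamentalVector act Y (act p g) +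
      tderiv 𝓘(ℝ, EP) 𝓘(ℝ, EP) (fun p => act p g) p (v i) := by
    intro i
    obtain ⟨Y, hY⟩ := h.exists_fundamentalVector_eq (p := act p g)
      (v := v' i - tderiv 𝓘(ℝ, EP) 𝓘(ℝ, EP) (fun p => act p g) p (v i))
      (by rw [map_sub, ← hv, h.tderiv_proj_right, sub_self])
    exact ⟨Y, by rw [hY, sub_add_cancel]⟩
  choose Y hY using hY
  have e1 : v = ![v 0, v 1] := by ext i; fin_cases i <;> rfl
  have e2 : v' = ![v' 0, v' 1] := by ext i; fin_cases i <;> rfl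
  have hh' : ∀ p (Y : E) W, η p ![W, fundamentalVector act Y p] = 0 := by
    intro p Y W
    rw [form_two_swap, hh, neg_zero]
  rw [e1, e2, hY 0, hY 1, form_two_add_left, hh, zero_add, form_two_add_right, hh', zero_add, hi]

end IsPrincipalBundle

end PrincipalBundles

/-! ## Central extensions and the circle bundle of a lifting -/

section Extensions

variable {E : Type*} [NormedAddCommGroup E] [NormedSpace ℝ E] [CompleteSpace E]
  {G : Type*} [TopologicalSpace G] [ChartedSpace E G] [Group G] [LieGroup 𝓘(ℝ, E) ∞ G]
  {E' : Type*} [NormedAddCommGroup E'] [NormedSpace ℝ E'] [CompleteSpace E']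
  {G' : Type*} [TopologicalSpace G'] [ChartedSpace E' G'] [Group G'] [LieGroup 𝓘(ℝ, E') ∞ G']
  {ι : Circle →* G'} {q : G' →* G}

namespace IsCentralExtension

variable (h : IsCentralExtension (E := E) (E' := E') ι q)
include h

theorem proj_incl (u : Circle) : q (ι u) = 1 := by
  have h1 : ι u ∈ q.ker := by
    rw [h.exact]
    exact ⟨u, rfl⟩
  exact h1

/-- This places the image of ι_* among the vertical vectors of the circle bundle `q` at 1.
Injectivity of ι_* and the inclusion ker q_* ⊆ im ι_* are thereby read off from the bundle
structure. -/
theorem lieMap_incl_eq (z : LieT) :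
    lieMap (E := LieT) (E' := E') ι z =
      fundamentalVector (E := LieT) (EP := E') (fun (g : G') (u : Circle) => g * ι u) z 1 := by
  rw [lieMap_eq, fundamentalVector_eq]
  simp only [one_mul]

theorem lieMap_incl_injective : Function.Injective (lieMap (E := LieT) (E' := E') ι) := by
  intro y z hyz
  rw [h.lieMap_incl_eq, h.lieMap_incl_eq] at hyz
  exact h.bundle.fundamentalVector_injective (E := LieT) 1 hyz

theorem centralCoord_incl (z : LieT) :
    centralCoord ι (lieMap (E := LieT) (E' := E') ι z) = z :=
  centralCoord_lieMap ι h.lieMap_incl_injective z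

theorem lieMap_incl_centralCoord {Y : E'} (hY : lieMap (E := E') (E' := E) q Y = 0) :
    lieMap (E := LieT) (E' := E') ι (centralCoord ι Y) = Y := by
  obtain ⟨z, hz⟩ := h.bundle.exists_fundamentalVector_eq (E := LieT) (p := (1 : G')) (v := Y) hY
  rw [← h.lieMap_incl_eq] at hz
  rw [← hz, h.centralCoord_incl]

theorem lieMap_proj_incl (z : LieT) :
    lieMap (E := E') (E' := E) q (lieMap (E := LieT) (E' := E') ι z) = 0 := by
  rw [← lieMap_comp h.smooth_proj h.smooth_incl]
  have h1 : q.comp ι = 1 := MonoidHom.ext h.proj_incl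
  rw [h1, lieMap_eq]
  exact DFunLike.congr_fun (tderiv_const (I := 𝓡 1) (I' := 𝓘(ℝ, E)) (1 : Circle) (1 : G)) z

theorem Ad_incl (u : Circle) : Ad (ι u) = ContinuousLinearMap.id ℝ E' :=
  Ad_of_mem_center (h.central ⟨u, rfl⟩)

theorem Ad_lieMap_incl (g : G') (z : LieT) :
    Ad g (lieMap (E := LieT) (E' := E') ι z) = lieMap (E := LieT) (E' := E') ι z :=
  Ad_lieMap_of_central h.smooth_incl h.central g z

theorem lieBracket_incl (Y : E') (z : LieT) :
    lieBracketCLM E' G' Y (lieMap (E := LieT) (E' := E') ι z) = 0 :=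
  lieBracketCLM_eq_zero_of_Ad (fun g => h.Ad_lieMap_incl g z) Y

end IsCentralExtension

variable {EX : Type*} [NormedAddCommGroup EX] [NormedSpace ℝ EX]
  {X : Type*} [TopologicalSpace X] [ChartedSpace EX X] [IsManifold 𝓘(ℝ, EX) ∞ X]
  {EB : Type*} [NormedAddCommGroup EB] [NormedSpace ℝ EB]
  {B : Type*} [TopologicalSpace B] [ChartedSpace EB B] [IsManifold 𝓘(ℝ, EB) ∞ B]
  {EB' : Type*} [NormedAddCommGroup EB'] [NormedSpace ℝ EB']
  {B' : Type*} [TopologicalSpace B'] [ChartedSpace EB' B'] [IsManifold 𝓘(ℝ, EB') ∞ B']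
  {π : B → X} {act : B → G → B} {π' : B' → X} {act' : B' → G' → B'} {r : B' → B}

/-- A local section of a principal bundle and the group valued coordinate which it defines. -/
theorem IsPrincipalBundle.exists_section_coordinate
    (hB : IsPrincipalBundle (EX := EX) (EP := EB) (E := E) π act)
    {U₀ : Set X} (hU₀ : IsOpen U₀) {s : X → B} (hs : ContMDiffOn 𝓘(ℝ, EX) 𝓘(ℝ, EB) ∞ s U₀)
    (hπs : ∀ x ∈ U₀, π (s x) = x) {x : X} (hx : x ∈ U₀) :
    ∃ U ⊆ U₀, IsOpen U ∧ x ∈ U ∧ ∃ φ : B → G, ContMDiffOn 𝓘(ℝ, EB) 𝓘(ℝ, E) ∞ φ (π ⁻¹' U) ∧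
      (∀ b, π b ∈ U → act (s (π b)) (φ b) = b) ∧
      ∀ y ∈ U, ∀ g, φ (act (s y) g) = g := by
  obtain ⟨e, hxe, hsm, -, he⟩ := hB.locally_trivial x
  have hsrc : ∀ y ∈ U₀ ∩ e.baseSet, ∀ g, act (s y) g ∈ e.source := fun y hy g =>
    e.mem_source.2 (by rw [hB.proj_act, hπs y hy.1]; exact hy.2)
  have hsrc' : ∀ y ∈ U₀ ∩ e.baseSet, s y ∈ e.source := fun y hy =>
    e.mem_source.2 (by rw [hπs y hy.1]; exact hy.2)
  -- The coordinate relative to `s` is the quotient of the `e`-coordinates of `b` and `s (π b)`;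
  -- this expression makes its smoothness evident.
  refine ⟨U₀ ∩ e.baseSet, inter_subset_left, hU₀.inter e.open_baseSet, ⟨hx, hxe⟩,
    fun b => ((e (s (π b))).2)⁻¹ * (e b).2, ?_, ?_, ?_⟩
  · intro b hb
    have hbs : b ∈ e.source := e.mem_source.2 hb.2
    have he2 : ∀ c ∈ e.source, ContMDiffAt 𝓘(ℝ, EB) 𝓘(ℝ, E) ∞ (fun b => (e b).2) c := fun c hc =>
      (hsm.contMDiffAt (e.open_source.mem_nhds hc)).snd
    have h1 : ContMDiffAt 𝓘(ℝ, EB) 𝓘(ℝ, EB) ∞ (fun b => s (π b)) b :=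
      ContMDiffAt.comp (g := s) (f := π) b (hs.contMDiffAt (hU₀.mem_nhds hb.1))
        hB.smooth_proj.contMDiffAt
    have h2 : ContMDiffAt 𝓘(ℝ, EB) 𝓘(ℝ, E) ∞ (fun b => (e (s (π b))).2) b :=
      ContMDiffAt.comp (g := fun b => (e b).2) (f := fun b => s (π b)) b
        (he2 _ (hsrc' _ hb)) h1
    exact (h2.inv.mul (he2 b hbs)).contMDiffWithinAt
  · intro b hb
    have hbs : b ∈ e.source := e.mem_source.2 hb.2
    have heq : e (act (s (π b)) (((e (s (π b))).2)⁻¹ * (e b).2)) = e b := by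
      refine Prod.ext ?_ ?_
      · rw [e.coe_fst hbs, e.coe_fst (hsrc _ hb _), hB.proj_act, hπs _ hb.1]
      · rw [he _ (hsrc' _ hb), mul_inv_cancel_left]
    exact e.injOn (hsrc _ hb _) hbs heq
  · intro y hy g
    have hy' : π (act (s y) g) = y := by rw [hB.proj_act, hπs y hy.1]
    change ((e (s (π (act (s y) g)))).2)⁻¹ * (e (act (s y) g)).2 = g
    rw [hy', he _ (hsrc' _ hy), inv_mul_cancel_left]

/-- The local trivialization of the circle bundle of a lifting. -/
theorem IsLifting.locally_trivial (hext : IsCentralExtension (E := E) (E' := E') ι q)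
    (hB : IsPrincipalBundle (EX := EX) (EP := EB) (E := E) π act)
    (hB' : IsPrincipalBundle (EX := EX) (EP := EB') (E := E') π' act')
    (hr : IsLifting (EB := EB) (EB' := EB') q π act π' act' r) (b₀ : B) :
    ∃ e : Bundle.Trivialization Circle r, b₀ ∈ e.baseSet ∧
      ContMDiffOn 𝓘(ℝ, EB') (𝓘(ℝ, EB).prod (𝓡 1)) ∞ e e.source ∧
      ContMDiffOn (𝓘(ℝ, EB).prod (𝓡 1)) 𝓘(ℝ, EB') ∞ e.toOpenPartialHomeomorph.symm e.target ∧
      ∀ p ∈ e.source, ∀ g, (e (act' p (ι g))).2 = (e p).2 * g := by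
  obtain ⟨b₀', hb₀'⟩ := hB'.surjective (π b₀)
  obtain ⟨U₁, s, hU₁, hx₁, hs, -, hπs⟩ := hB'.hasLocalSections.exists_section b₀'
  rw [hb₀'] at hx₁
  obtain ⟨U₂, hU₂₁, hU₂, hx₂, φ', hφ', hsφ', hφ's⟩ :=
    hB'.exists_section_coordinate hU₁ hs hπs hx₁
  -- The section of `B` is the image under `r` of the section of `B'`. With this choice the group
  -- coordinates satisfy φ ∘ r = q ∘ φ', so that locally `r` looks like `id × q`.
  obtain ⟨U, hU₂', hU, hx, φ, hφ, hsφ, hφs⟩ :=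
    hB.exists_section_coordinate (s := fun x => r (s x)) hU₂
      (hr.smooth.comp_contMDiffOn (hs.mono hU₂₁))
      (fun x hx => (hr.proj _).trans (hπs x (hU₂₁ hx))) hx₂
  have hπB : IsOpen (π ⁻¹' U) := hU.preimage hB.smooth_proj.continuous
  have hπB' : IsOpen (π' ⁻¹' U₂) := hU₂.preimage hB'.smooth_proj.continuous
  obtain ⟨e, hxe, hsm, hsymm, he⟩ := hext.bundle.locally_trivial (φ b₀)
  have hφr : ∀ b', π' b' ∈ U → φ (r b') = q (φ' b') := by
    intro b' hb'
    have h1 : r b' = act (r (s (π' b'))) (q (φ' b')) := by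
      rw [← hr.equivariant, hsφ' b' (hU₂' hb')]
    rw [h1, hφs _ hb']
  let W : Set B := π ⁻¹' U ∩ φ ⁻¹' e.baseSet
  have hW : IsOpen W := hφ.continuousOn.isOpen_inter_preimage hπB e.open_baseSet
  have hsrc : ∀ b', r b' ∈ W → φ' b' ∈ e.source := fun b' hb' => by
    have hU' : π' b' ∈ U := by rw [← hr.proj]; exact hb'.1
    refine e.mem_source.2 ?_
    rw [← hφr b' hU']
    exact hb'.2
  have htgt : ∀ b ∈ W, ∀ u : Circle, (φ b, u) ∈ e.target := fun b hb u => by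
    rw [e.target_eq]
    exact ⟨hb.2, mem_univ _⟩
  -- A trivialization `e` of `q` near `φ b₀` is transported to `r`: the circle coordinate of `b'` is
  -- that of `φ' b'`.
  let f : B' → B × Circle := fun b' => (r b', (e (φ' b')).2)
  let g : B × Circle → B' := fun z => act' (s (π z.1)) (e.toOpenPartialHomeomorph.symm (φ z.1, z.2))
  have hπg : ∀ z : B × Circle, z.1 ∈ W → π' (g z) = π z.1 := fun z hz => by
    rw [hB'.proj_act, hπs _ (hU₂₁ (hU₂' hz.1))]
  have hrg : ∀ z : B × Circle, z.1 ∈ W → r (g z) = z.1 := fun z hz => by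
    rw [hr.equivariant, e.proj_symm_apply' hz.2, hsφ _ hz.1]
  have hφg : ∀ z : B × Circle, z.1 ∈ W →
      φ' (g z) = e.toOpenPartialHomeomorph.symm (φ z.1, z.2) := fun z hz =>
    hφ's _ (hU₂' hz.1) _
  have hf : ContMDiffOn 𝓘(ℝ, EB') (𝓘(ℝ, EB).prod (𝓡 1)) ∞ f (r ⁻¹' W) := by
    intro b' hb'
    have hU' : π' b' ∈ U₂ := by rw [← hr.proj]; exact hU₂' hb'.1
    have h1 : ContMDiffAt 𝓘(ℝ, EB') (𝓘(ℝ, E).prod (𝓡 1)) ∞ (fun b' => e (φ' b')) b' :=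
      ContMDiffAt.comp (g := e) (f := φ') (I' := 𝓘(ℝ, E')) b'
        (hsm.contMDiffAt (e.open_source.mem_nhds (hsrc b' hb')))
        (hφ'.contMDiffAt (hπB'.mem_nhds hU'))
    exact (hr.smooth.contMDiffAt.prodMk h1.snd).contMDiffWithinAt
  have hg : ContMDiffOn (𝓘(ℝ, EB).prod (𝓡 1)) 𝓘(ℝ, EB') ∞ g (W ×ˢ univ) := by
    intro z hz
    have h0 : ContMDiffAt (𝓘(ℝ, EB).prod (𝓡 1)) 𝓘(ℝ, EX) ∞ (fun z : B × Circle => π z.1) z :=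
      (hB.smooth_proj.comp contMDiff_fst).contMDiffAt
    have h1 : ContMDiffAt (𝓘(ℝ, EB).prod (𝓡 1)) 𝓘(ℝ, EB') ∞ (fun z : B × Circle => s (π z.1)) z :=
      ContMDiffAt.comp (g := s) (f := fun z : B × Circle => π z.1) z
        (hs.contMDiffAt (hU₁.mem_nhds (hU₂₁ (hU₂' hz.1.1)))) h0
    have h2 : ContMDiffAt (𝓘(ℝ, EB).prod (𝓡 1)) 𝓘(ℝ, E) ∞ (fun z : B × Circle => φ z.1) z :=
      ContMDiffAt.comp (g := φ) (f := Prod.fst) z (hφ.contMDiffAt (hπB.mem_nhds hz.1.1))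
        contMDiffAt_fst
    have h3 : ContMDiffAt (𝓘(ℝ, EB).prod (𝓡 1)) 𝓘(ℝ, E') ∞
        (fun z : B × Circle => e.toOpenPartialHomeomorph.symm (φ z.1, z.2)) z :=
      ContMDiffAt.comp (g := e.toOpenPartialHomeomorph.symm)
        (f := fun z : B × Circle => (φ z.1, z.2)) (I' := 𝓘(ℝ, E).prod (𝓡 1)) z
        (hsymm.contMDiffAt (e.open_target.mem_nhds (htgt _ hz.1 _))) (h2.prodMk contMDiffAt_snd)
    exact (ContMDiffAt.comp (g := fun p : B' × G' => act' p.1 p.2)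
      (f := fun z : B × Circle => (s (π z.1), e.toOpenPartialHomeomorph.symm (φ z.1, z.2)))
      (I' := 𝓘(ℝ, EB').prod 𝓘(ℝ, E')) z hB'.smooth_act.contMDiffAt
      (h1.prodMk h3)).contMDiffWithinAt
  let t : Bundle.Trivialization Circle r :=
    { toFun := f
      invFun := g
      source := r ⁻¹' W
      target := W ×ˢ univ
      map_source' := fun b' hb' => ⟨hb', mem_univ _⟩
      map_target' := fun z hz => by
        change r (g z) ∈ W
        rw [hrg z hz.1]
        exact hz.1
      left_inv' := fun b' hb' => by
        have hU' : π' b' ∈ U := by rw [← hr.proj]; exact hb'.1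
        change act' (s (π (r b'))) (e.toOpenPartialHomeomorph.symm (φ (r b'), (e (φ' b')).2)) = b'
        have h1 : (φ (r b'), (e (φ' b')).2) = e (φ' b') :=
          Prod.ext ((hφr b' hU').trans (e.coe_fst (hsrc b' hb')).symm) rfl
        rw [h1, hr.proj]
        have h2 : e.toOpenPartialHomeomorph.symm (e (φ' b')) = φ' b' := e.left_inv (hsrc b' hb')
        rw [h2, hsφ' b' (hU₂' hU')]
      right_inv' := fun z hz => by
        refine Prod.ext (hrg z hz.1) ?_
        change (e (φ' (g z))).2 = z.2
        rw [hφg z hz.1]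
        have h2 : e (e.toOpenPartialHomeomorph.symm (φ z.1, z.2)) = (φ z.1, z.2) :=
          e.right_inv (htgt _ hz.1 _)
        rw [h2]
      open_source := hW.preimage hr.smooth.continuous
      open_target := hW.prod isOpen_univ
      continuousOn_toFun := hf.continuousOn
      continuousOn_invFun := hg.continuousOn
      baseSet := W
      open_baseSet := hW
      source_eq := rfl
      target_eq := rfl
      proj_toFun := fun _ _ => rfl }
  refine ⟨t, ⟨hx, hxe⟩, hf, hg, fun b' hb' u => ?_⟩
  have hb'W : r b' ∈ W := hb'
  have hU' : π' b' ∈ U₂ := by rw [← hr.proj]; exact hU₂' hb'W.1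
  change (e (φ' (act' b' (ι u)))).2 = (e (φ' b')).2 * u
  rw [← he _ (hsrc b' hb'W)]
  congr 3
  conv_lhs => rw [← hsφ' b' hU', ← hB'.act_mul, hφ's _ hU']

theorem IsLifting.isPrincipalBundle (hext : IsCentralExtension (E := E) (E' := E') ι q)
    (hB : IsPrincipalBundle (EX := EX) (EP := EB) (E := E) π act)
    (hB' : IsPrincipalBundle (EX := EX) (EP := EB') (E := E') π' act')
    (hr : IsLifting (EB := EB) (EB' := EB') q π act π' act' r) :
    IsPrincipalBundle (EX := EB) (EP := EB') (E := LieT) r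
      (fun (b : B') (u : Circle) => act' b (ι u)) where
  smooth_proj := hr.smooth
  smooth_act := hB'.smooth_act.comp
    (contMDiff_fst.prodMk (hext.smooth_incl.comp contMDiff_snd))
  act_one p := by rw [map_one, hB'.act_one]
  act_mul p g h := by rw [map_mul, hB'.act_mul]
  proj_act p g := by rw [hr.equivariant, hext.proj_incl, hB.act_one]
  locally_trivial := hr.locally_trivial hext hB hB'

end Extensions

/-! ## The projection to the central line defined by a split -/

section VerticalProjection

variable {E : Type*} [NormedAddCommGroup E] [NormedSpace ℝ E] [CompleteSpace E]
  {G : Type*} [TopologicalSpace G] [ChartedSpace E G] [Group G] [LieGroup 𝓘(ℝ, E) ∞ G]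
  {E' : Type*} [NormedAddCommGroup E'] [NormedSpace ℝ E'] [CompleteSpace E']
  {G' : Type*} [TopologicalSpace G'] [ChartedSpace E' G'] [Group G'] [LieGroup 𝓘(ℝ, E') ∞ G']

/-- The projection of `Lie G'` to the central line along the image of a split. -/
noncomputable def verticalProj (ι : Circle →* G') (q : G' →* G) (σ : E →L[ℝ] E') : E' →L[ℝ] LieT :=
  centralCoord ι ∘L (ContinuousLinearMap.id ℝ E' - σ ∘L lieMap (E := E') (E' := E) q)

theorem verticalProj_apply (ι : Circle →* G') (q : G' →* G) (σ : E →L[ℝ] E') (Y : E') :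
    verticalProj ι q σ Y = centralCoord ι (Y - σ (lieMap (E := E') (E' := E) q Y)) := rfl

variable {ι : Circle →* G'} {q : G' →* G} {σ : E →L[ℝ] E'}

namespace IsCentralExtension

variable (h : IsCentralExtension (E := E) (E' := E') ι q)
include h

theorem lieMap_verticalProj (hσ : IsSplit q σ) (Y : E') :
    lieMap (E := LieT) (E' := E') ι (verticalProj ι q σ Y) =
      Y - σ (lieMap (E := E') (E' := E) q Y) := by
  rw [verticalProj_apply, h.lieMap_incl_centralCoord (by rw [map_sub, hσ, sub_self])]

theorem verticalProj_incl (z : LieT) :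
    verticalProj ι q σ (lieMap (E := LieT) (E' := E') ι z) = z := by
  rw [verticalProj_apply, h.lieMap_proj_incl, map_zero, sub_zero, h.centralCoord_incl]

theorem eq_add_verticalProj (hσ : IsSplit q σ) (Y : E') :
    Y = σ (lieMap (E := E') (E' := E) q Y) +
      lieMap (E := LieT) (E' := E') ι (verticalProj ι q σ Y) := by
  rw [h.lieMap_verticalProj hσ, add_sub_cancel]

/-- Since q_*[σY, σZ] = [Y, Z], the cocycle is exactly the vertical component of [σY, σZ]. -/
theorem lieCocycle_apply (hσ : IsSplit q σ) (Y Z : E) :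
    lieCocycle G ι σ Y Z = verticalProj ι q σ (lieBracketCLM E' G' (σ Y) (σ Z)) := by
  rw [verticalProj_apply, lieMap_lieBracketCLM h.smooth_proj, hσ, hσ]
  rfl

theorem groupCocycle_apply (hσ : IsSplit q σ) (γ : G') (Y : E) :
    groupCocycle ι q σ γ Y = verticalProj ι q σ (Ad γ (σ Y)) := by
  rw [verticalProj_apply, lieMap_Ad h.smooth_proj, hσ]
  rfl

/-- Decompose both arguments along σ and the central line; brackets with central elements vanish, so
only the σ-components contribute. -/
theorem verticalProj_lieBracket (hσ : IsSplit q σ) (Y Z : E') :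
    verticalProj ι q σ (lieBracketCLM E' G' Y Z) =
      lieCocycle G ι σ (lieMap (E := E') (E' := E) q Y) (lieMap (E := E') (E' := E) q Z) := by
  rw [h.lieCocycle_apply hσ]
  conv_lhs => rw [h.eq_add_verticalProj hσ Y, h.eq_add_verticalProj hσ Z]
  rw [map_add, h.lieBracket_incl, add_zero, lieBracketCLM_skew, map_add, h.lieBracket_incl,
    add_zero, ← lieBracketCLM_skew]

/-- `Ad` fixes the central component and moves the σ-component by the group cocycle. -/
theorem verticalProj_Ad (hσ : IsSplit q σ) (γ : G') (Y : E') :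
    verticalProj ι q σ (Ad γ Y) =
      groupCocycle ι q σ γ (lieMap (E := E') (E' := E) q Y) + verticalProj ι q σ Y := by
  conv_lhs => rw [h.eq_add_verticalProj hσ Y]
  rw [map_add, map_add, h.Ad_lieMap_incl, h.verticalProj_incl, h.groupCocycle_apply hσ]

theorem extensionConnection_eq :
    extensionConnection ι q σ = mapForm (verticalProj ι q σ) (maurerCartan E' G') := by
  rw [extensionConnection, pullback_maurerCartan h.smooth_proj]
  rfl

end IsCentralExtension

variable {EX : Type*} [NormedAddCommGroup EX] [NormedSpace ℝ EX]
  {X : Type*} [TopologicalSpace X] [ChartedSpace EX X] [IsManifold 𝓘(ℝ, EX) ∞ X]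
  {EB : Type*} [NormedAddCommGroup EB] [NormedSpace ℝ EB]
  {B : Type*} [TopologicalSpace B] [ChartedSpace EB B] [IsManifold 𝓘(ℝ, EB) ∞ B]
  {EB' : Type*} [NormedAddCommGroup EB'] [NormedSpace ℝ EB']
  {B' : Type*} [TopologicalSpace B'] [ChartedSpace EB' B'] [IsManifold 𝓘(ℝ, EB') ∞ B']
  {π : B → X} {act : B → G → B} {π' : B' → X} {act' : B' → G' → B'} {r : B' → B}
  {θ : DForm EB B 1 E} {θ' : DForm EB' B' 1 E'} {L : B → E' →L[ℝ] LieT}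

/-! ## The vertical part of a compatible connection -/

namespace IsCompatible

variable (hcomp : IsCompatible q r θ θ')
include hcomp

theorem lieMap_apply (b : B') (v : EB') :
    lieMap (E := E') (E' := E) q (θ' b ![v]) = θ (r b) ![tderiv 𝓘(ℝ, EB') 𝓘(ℝ, EB) r b v] := by
  have h := DFunLike.congr_fun (congrFun hcomp b) ![v]
  rw [pullback_one] at h
  exact h

theorem verticalPart_eq : verticalPart ι σ r θ θ' = mapForm (verticalProj ι q σ) θ' := by
  rw [verticalPart, ← hcomp]
  rfl

/-- Off the central line `centralCoord` depends on a choice of left inverse. This identity shows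
that no information is lost in applying it: θ' - σ(r^*θ) really is iℝ-valued, as its image under q_*
is zero. -/
theorem mapForm_incl_verticalPart (hext : IsCentralExtension (E := E) (E' := E') ι q)
    (hσ : IsSplit q σ) :
    mapForm (lieMap ι) (verticalPart ι σ r θ θ') =
      θ' - mapForm σ (pullback 𝓘(ℝ, EB') 𝓘(ℝ, EB) r θ) := by
  rw [hcomp.verticalPart_eq (ι := ι) (σ := σ), ← hcomp]
  funext b
  refine form_one_ext fun v => ?_
  exact hext.lieMap_verticalProj hσ _

end IsCompatible

end VerticalProjection

/-! ### Curvatures on a lifting and the pull-back of the curving -/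

section Lifting

variable {E : Type*} [NormedAddCommGroup E] [NormedSpace ℝ E] [CompleteSpace E]
  {G : Type*} [TopologicalSpace G] [ChartedSpace E G] [Group G] [LieGroup 𝓘(ℝ, E) ∞ G]
  {E' : Type*} [NormedAddCommGroup E'] [NormedSpace ℝ E'] [CompleteSpace E']
  {G' : Type*} [TopologicalSpace G'] [ChartedSpace E' G'] [Group G'] [LieGroup 𝓘(ℝ, E') ∞ G']
  {ι : Circle →* G'} {q : G' →* G} {σ : E →L[ℝ] E'}
  {EX : Type*} [NormedAddCommGroup EX] [NormedSpace ℝ EX]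
  {X : Type*} [TopologicalSpace X] [ChartedSpace EX X] [IsManifold 𝓘(ℝ, EX) ∞ X]
  {EB : Type*} [NormedAddCommGroup EB] [NormedSpace ℝ EB]
  {B : Type*} [TopologicalSpace B] [ChartedSpace EB B] [IsManifold 𝓘(ℝ, EB) ∞ B]
  {EB' : Type*} [NormedAddCommGroup EB'] [NormedSpace ℝ EB']
  {B' : Type*} [TopologicalSpace B'] [ChartedSpace EB' B'] [IsManifold 𝓘(ℝ, EB') ∞ B']
  {π : B → X} {act : B → G → B} {π' : B' → X} {act' : B' → G' → B'} {r : B' → B}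
  {θ : DForm EB B 1 E} {θ' : DForm EB' B' 1 E'} {L : B → E' →L[ℝ] LieT}

theorem IsSmoothForm.mapForm {F F' : Type*} [NormedAddCommGroup F] [NormedSpace ℝ F]
    [NormedAddCommGroup F'] [NormedSpace ℝ F'] {k : ℕ} {η : DForm EB B k F}
    (h : IsSmoothForm 𝓘(ℝ, EB) η) (A : F →L[ℝ] F') : IsSmoothForm 𝓘(ℝ, EB) (mapForm A η) :=
  isSmoothForm_iff.2 fun x => (isSmoothForm_iff.1 h x).mapForm A

theorem fundamentalVector_comp_incl (hext : IsCentralExtension (E := E) (E' := E') ι q)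
    (ha : IsSmoothAction (EP := EB') (E := E') act') (b : B') (z : LieT) :
    fundamentalVector (E := LieT) (EP := EB') (fun (b : B') (u : Circle) => act' b (ι u)) z b =
      fundamentalVector act' (lieMap (E := LieT) (E' := E') ι z) b := by
  have h := tderiv_comp_apply (g := act' b) (f := ι) (x := 1)
    ((ha.contMDiff_left b).mdiffAt (ι 1)) (hext.smooth_incl.mdiffAt 1) z
  rw [map_one] at h
  exact h

/-- The vertical part of a compatible connection on a lifting is a connection on the circle bundle
of the lifting. -/
theorem IsConnection.verticalPart (hext : IsCentralExtension (E := E) (E' := E') ι q)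
    (ha : IsSmoothAction (EP := EB') (E := E') act') (hθ' : IsConnection act' θ')
    (hcomp : IsCompatible q r θ θ') :
    IsConnection (fun (b : B') (u : Circle) => act' b (ι u)) (verticalPart ι σ r θ θ') := by
  rw [hcomp.verticalPart_eq]
  refine ⟨hθ'.smooth.mapForm _, fun b z => ?_, fun u => ?_⟩
  · rw [fundamentalVector_comp_incl hext ha]
    change verticalProj ι q σ (θ' b ![_]) = z
    rw [hθ'.fundamental, hext.verticalProj_incl]
  · have hu : Ad (E := LieT) u⁻¹ = ContinuousLinearMap.id ℝ LieT :=
      Ad_of_mem_center (Subgroup.mem_center_iff.2 fun v => mul_comm v _)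
    rw [hu]
    funext b
    refine form_one_ext fun v => ?_
    rw [pullback_one]
    change verticalProj ι q σ (θ' (act' b (ι u)) ![_]) = verticalProj ι q σ (θ' b ![v])
    rw [hθ'.apply_right, ← map_inv, hext.Ad_incl]
    rfl

/-- The curvature of a connection on a principal circle bundle descends to the base. -/
theorem IsPrincipalBundle.existsUnique_isBaseCurvature {actT : B' → Circle → B'}
    (h : IsPrincipalBundle (EX := EB) (EP := EB') (E := LieT) r actT) {N : DForm EB' B' 1 LieT}
    (hN : IsConnection actT N) : ∃! F : DForm EB B 2 LieT, IsBaseCurvature r N F := by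
  have h1 := h.existsUnique_descend_two (isSmoothForm_curvature (G := Circle) hN.smooth)
    (hN.curvature_horizontal h.isSmoothAction) fun p u v w => by
      rw [hN.curvature_right h.isSmoothAction,
        Ad_of_mem_center (E := LieT) (Subgroup.mem_center_iff.2 fun v => mul_comm v _)]
      rfl
  obtain ⟨F, hF, hu⟩ := h1
  exact ⟨F, ⟨hF.1, hF.2⟩, fun F' hF' => hu F' ⟨hF'.1, hF'.2⟩⟩

/-- L ∘ F_θ' is horizontal because F_θ' is. It is invariant because the factor Ad_{γ⁻¹} in the
transformation of F_θ' is absorbed by the invariance of `L`. -/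
theorem IsLifting.existsUnique_isScalarCurvature
    (hB' : IsPrincipalBundle (EX := EX) (EP := EB') (E := E') π' act')
    (hr : IsLifting (EB := EB) (EB' := EB') q π act π' act' r)
    (hL : IsSplitting (EB := EB) ι q act L) (hθ' : IsConnection act' θ') :
    ∃! K : DForm EX X 2 LieT, IsScalarCurvature L G' π' r θ' K := by
  have hs : IsSmoothForm 𝓘(ℝ, EB') fun b =>
      (L (r b)).compContinuousAlternatingMap (curvature 𝓘(ℝ, EB') G' θ' b) :=
    isSmoothForm_iff.2 fun b => (isSmoothForm_iff.1 (isSmoothForm_curvature hθ'.smooth) b).coeff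
      (hL.smooth.comp hr.smooth).contMDiffAt
  have h1 := hB'.existsUnique_descend_two hs
    (fun p Y W => by
      change L (r p) (curvature 𝓘(ℝ, EB') G' θ' p ![_, W]) = 0
      rw [hθ'.curvature_horizontal hB'.isSmoothAction, map_zero])
    fun p g v w => by
      change L (r (act' p g)) (curvature 𝓘(ℝ, EB') G' θ' (act' p g) ![_, _]) =
        L (r p) (curvature 𝓘(ℝ, EB') G' θ' p ![v, w])
      rw [hθ'.curvature_right hB'.isSmoothAction, hr.equivariant, hL.invariant]
  obtain ⟨K, hK, hu⟩ := h1
  exact ⟨K, ⟨hK.1, hK.2⟩, fun K' hK' => hu K' ⟨hK'.1, hK'.2⟩⟩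

theorem IsCompatible.dForm_verticalPart (hcomp : IsCompatible q r θ θ')
    (hθ' : IsSmoothForm 𝓘(ℝ, EB') θ') (b : B') :
    dForm 𝓘(ℝ, EB') (verticalPart ι σ r θ θ') b =
      (verticalProj ι q σ).compContinuousAlternatingMap (dForm 𝓘(ℝ, EB') θ' b) := by
  rw [hcomp.verticalPart_eq, dForm_mapForm _ (isSmoothForm_iff.1 hθ' b)]

/-- The map q_* respects brackets and commutes with `d`, so compatibility of the connections passes
to their curvatures. -/
theorem IsCompatible.lieMap_curvature (hext : IsCentralExtension (E := E) (E' := E') ι q)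
    (hcomp : IsCompatible q r θ θ') (hr : ContMDiff 𝓘(ℝ, EB') 𝓘(ℝ, EB) ∞ r)
    (hθ : IsSmoothForm 𝓘(ℝ, EB) θ) (hθ' : IsSmoothForm 𝓘(ℝ, EB') θ') (b : B') (v w : EB') :
    lieMap (E := E') (E' := E) q (curvature 𝓘(ℝ, EB') G' θ' b ![v, w]) =
      pullback 𝓘(ℝ, EB') 𝓘(ℝ, EB) r (curvature 𝓘(ℝ, EB) G θ) b ![v, w] := by
  have h1 := dForm_pullback (I := 𝓘(ℝ, EB')) (I' := 𝓘(ℝ, EB)) (f := r) (η := θ) (x := b)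
    (isSmoothForm_iff.1 hθ (r b)) hr.contMDiffAt
  rw [← hcomp, dForm_mapForm _ (isSmoothForm_iff.1 hθ' b)] at h1
  have h2 := DFunLike.congr_fun h1 ![v, w]
  rw [pullback_two] at h2 ⊢
  rw [curvature_apply, curvature_apply, map_add, lieMap_lieBracketCLM hext.smooth_proj,
    hcomp.lieMap_apply, hcomp.lieMap_apply, ← h2]
  rfl

/-- As for the curvature, skew symmetry of the cocycle absorbs the factor ½. -/
theorem curving_apply (hext : IsCentralExtension (E := E) (E' := E') ι q) (hσ : IsSplit q σ)
    (b : B) (v w : EB) :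
    curving G ι L σ θ b ![v, w] = -lieCocycle G ι σ (θ b ![v]) (θ b ![w]) -
      L b (σ (curvature 𝓘(ℝ, EB) G θ b ![v, w])) := by
  have h : curving G ι L σ θ b ![v, w] =
    -((1 / 2 : ℝ) • wedge (lieCocycle G ι σ) θ θ b ![v, w]) -
      L b (σ (curvature 𝓘(ℝ, EB) G θ b ![v, w])) := rfl
  rw [h, wedge_apply, hext.lieCocycle_apply hσ (θ b ![w]), lieBracketCLM_skew, map_neg,
    ← hext.lieCocycle_apply hσ, sub_neg_eq_add, smul_add, ← add_smul, add_halves, one_smul]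

/-- The pull-back of the curving to a lifting. -/
theorem pullback_curving (hext : IsCentralExtension (E := E) (E' := E') ι q) (hσ : IsSplit q σ)
    (hcomp : IsCompatible q r θ θ') (hr : ContMDiff 𝓘(ℝ, EB') 𝓘(ℝ, EB) ∞ r)
    (hL : IsSplitting (EB := EB) ι q act L) (hθ : IsSmoothForm 𝓘(ℝ, EB) θ)
    (hθ' : IsSmoothForm 𝓘(ℝ, EB') θ') :
    pullback 𝓘(ℝ, EB') 𝓘(ℝ, EB) r (curving G ι L σ θ) =
      dForm 𝓘(ℝ, EB') (verticalPart ι σ r θ θ') - fun b =>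
        (L (r b)).compContinuousAlternatingMap (curvature 𝓘(ℝ, EB') G' θ' b) := by
  funext b
  refine form_two_ext fun v w => ?_
  have h1 : (dForm 𝓘(ℝ, EB') (verticalPart ι σ r θ θ') - fun b =>
      (L (r b)).compContinuousAlternatingMap (curvature 𝓘(ℝ, EB') G' θ' b)) b ![v, w] =
      dForm 𝓘(ℝ, EB') (verticalPart ι σ r θ θ') b ![v, w] -
        L (r b) (curvature 𝓘(ℝ, EB') G' θ' b ![v, w]) := rfl
  have h2 : dForm 𝓘(ℝ, EB') (verticalPart ι σ r θ θ') b ![v, w] =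
      verticalProj ι q σ (dForm 𝓘(ℝ, EB') θ' b ![v, w]) := by
    rw [hcomp.dForm_verticalPart hθ']
    rfl
  -- Here the normalization of `L` on the central line enters: the vertical component of F_θ' passes
  -- through `L` unchanged, and the remaining component becomes r^*κ.
  have h3 : L (r b) (curvature 𝓘(ℝ, EB') G' θ' b ![v, w]) =
      L (r b) (σ (pullback 𝓘(ℝ, EB') 𝓘(ℝ, EB) r (curvature 𝓘(ℝ, EB) G θ) b ![v, w])) +
        verticalProj ι q σ (curvature 𝓘(ℝ, EB') G' θ' b ![v, w]) := by
    conv_lhs => rw [hext.eq_add_verticalProj hσ (curvature 𝓘(ℝ, EB') G' θ' b ![v, w])]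
    rw [map_add, hL.identity, hcomp.lieMap_curvature hext hr hθ hθ']
  rw [h1, h2, h3, pullback_two, pullback_two, curving_apply hext hσ, curvature_apply θ', map_add,
    hext.verticalProj_lieBracket hσ, hcomp.lieMap_apply, hcomp.lieMap_apply]
  abel

end Lifting

/-! ## The lifting bundle gerbe -/

section Gerbe

variable {E : Type*} [NormedAddCommGroup E] [NormedSpace ℝ E] [CompleteSpace E]
  {G : Type*} [TopologicalSpace G] [ChartedSpace E G] [Group G] [LieGroup 𝓘(ℝ, E) ∞ G]
  {E' : Type*} [NormedAddCommGroup E'] [NormedSpace ℝ E'] [CompleteSpace E']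
  {G' : Type*} [TopologicalSpace G'] [ChartedSpace E' G'] [Group G'] [LieGroup 𝓘(ℝ, E') ∞ G']
  {ι : Circle →* G'} {q : G' →* G} {σ : E →L[ℝ] E'}
  {EX : Type*} [NormedAddCommGroup EX] [NormedSpace ℝ EX]
  {X : Type*} [TopologicalSpace X] [ChartedSpace EX X] [IsManifold 𝓘(ℝ, EX) ∞ X]
  {EB : Type*} [NormedAddCommGroup EB] [NormedSpace ℝ EB]
  {B : Type*} [TopologicalSpace B] [ChartedSpace EB B] [IsManifold 𝓘(ℝ, EB) ∞ B]
  {EB' : Type*} [NormedAddCommGroup EB'] [NormedSpace ℝ EB']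
  {B' : Type*} [TopologicalSpace B'] [ChartedSpace EB' B'] [IsManifold 𝓘(ℝ, EB') ∞ B']
  {π : B → X} {act : B → G → B} {π' : B' → X} {act' : B' → G' → B'} {r : B' → B}
  {θ : DForm EB B 1 E} {θ' : DForm EB' B' 1 E'} {L : B → E' →L[ℝ] LieT}

/-- Identities of forms on J_B = B × G' may therefore be checked on B' × G', where the connection
`N` is available. -/
theorem HasLocalSections.prodMap_id (h : HasLocalSections 𝓘(ℝ, EB') 𝓘(ℝ, EB) r) :
    HasLocalSections (𝓘(ℝ, EB').prod 𝓘(ℝ, E')) (𝓘(ℝ, EB).prod 𝓘(ℝ, E'))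
      (fun z : B' × G' => (r z.1, z.2)) where
  smooth := (h.smooth.comp contMDiff_fst).prodMk contMDiff_snd
  surjective z := by
    obtain ⟨b, hb⟩ := h.surjective z.1
    exact ⟨(b, z.2), Prod.ext hb rfl⟩
  exists_section z := by
    obtain ⟨U, s, hU, hz, hs, hsz, hrs⟩ := h.exists_section z.1
    refine ⟨U ×ˢ univ, fun y => (s y.1, y.2), hU.prod isOpen_univ, ⟨hz, mem_univ _⟩, ?_,
      Prod.ext hsz rfl, fun y hy => Prod.ext (hrs y.1 hy.1) rfl⟩
    exact (hs.comp contMDiffOn_fst fun y hy => hy.1).prodMk contMDiffOn_snd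

theorem tderiv_prodMap_id (hr : ContMDiff 𝓘(ℝ, EB') 𝓘(ℝ, EB) ∞ r) (z : B' × G') (v : EB')
    (w : E') :
    tderiv (𝓘(ℝ, EB').prod 𝓘(ℝ, E')) (𝓘(ℝ, EB).prod 𝓘(ℝ, E'))
      (fun z : B' × G' => (r z.1, z.2)) z (v, w) = (tderiv 𝓘(ℝ, EB') 𝓘(ℝ, EB) r z.1 v, w) := by
  rw [tderiv_prodMk (f := fun z : B' × G' => r z.1) (g := Prod.snd)
    ((hr.comp contMDiff_fst).mdiffAt z) (contMDiff_snd.mdiffAt z), tderiv_snd,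
    tderiv_comp_apply (g := r) (f := Prod.fst) (hr.mdiffAt z.1) (contMDiff_fst.mdiffAt z),
    tderiv_fst]
  rfl

/-- On the pull-back of the lifting bundle gerbe to a lifting, the gerbe connection is the
difference of the two pull-backs of the vertical part. -/
theorem pullback_gerbeConnection (hext : IsCentralExtension (E := E) (E' := E') ι q)
    (hσ : IsSplit q σ) (ha : IsSmoothAction (EP := EB') (E := E') act')
    (hcomp : IsCompatible q r θ θ') (hr : ContMDiff 𝓘(ℝ, EB') 𝓘(ℝ, EB) ∞ r)
    (hθ' : IsConnection act' θ') :
    pullback (𝓘(ℝ, EB').prod 𝓘(ℝ, E')) (𝓘(ℝ, EB).prod 𝓘(ℝ, E'))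
        (fun z : B' × G' => (r z.1, z.2)) (gerbeConnection ι q σ θ) =
      pullback (𝓘(ℝ, EB').prod 𝓘(ℝ, E')) 𝓘(ℝ, EB') (fun z : B' × G' => act' z.1 z.2)
          (verticalPart ι σ r θ θ') -
        pullback (𝓘(ℝ, EB').prod 𝓘(ℝ, E')) 𝓘(ℝ, EB') Prod.fst (verticalPart ι σ r θ θ') := by
  funext z
  refine form_one_ext fun u => ?_
  obtain ⟨b, γ⟩ := z
  obtain ⟨v, w⟩ := u
  have h1 : ∀ (α β : DForm (EB' × E') (B' × G') 1 LieT) (z : B' × G') (u : EB' × E'),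
      (α - β) z ![u] = α z ![u] - β z ![u] := fun _ _ _ _ => rfl
  have h2 : ∀ (p : B × G') (x : EB) (y : E'), gerbeConnection ι q σ θ p ![(x, y)] =
      verticalProj ι q σ (maurerCartan E' G' p.2 ![y]) +
        groupCocycle ι q σ p.2⁻¹ (θ p.1 ![x]) := by
    intro p x y
    have h : gerbeConnection ι q σ θ p ![(x, y)] =
      pullback (𝓘(ℝ, EB).prod 𝓘(ℝ, E')) 𝓘(ℝ, E') (Prod.snd : B × G' → G')
        (extensionConnection ι q σ) p ![(x, y)] +
      groupCocycle ι q σ p.2⁻¹ (pullback (𝓘(ℝ, EB).prod 𝓘(ℝ, E')) 𝓘(ℝ, EB)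
        (Prod.fst : B × G' → B) θ p ![(x, y)]) := rfl
    rw [h, pullback_one, pullback_one, tderiv_snd, tderiv_fst, hext.extensionConnection_eq]
    rfl
  have h3 : ∀ (b : B') (x : EB'), verticalPart ι σ r θ θ' b ![x] =
      verticalProj ι q σ (θ' b ![x]) := fun b x => by
    rw [hcomp.verticalPart_eq]
    rfl
  -- On the action map θ' becomes Ad_{γ⁻¹} θ' + μ'. Its vertical projection is Z_σ(γ⁻¹, θ) + p(θ') +
  -- p(μ'), where p(μ') = ν_σ; subtracting p(θ') leaves the gerbe connection.
  rw [h1, pullback_one, pullback_one, pullback_one, tderiv_prodMap_id hr, h2, h3, h3,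
    hθ'.apply_tderiv ha, tderiv_fst, map_add, hext.verticalProj_Ad hσ, hcomp.lieMap_apply]
  change _ = _ - verticalProj ι q σ (θ' b ![v])
  abel

/-- F_N alone is a curving, since the gerbe connection is upstairs a difference of two copies of
`N`. Subtracting any form pulled back from `X` does not disturb this, because the two maps J_B → B
have the same composite with π. -/
theorem isCurving_curving (hext : IsCentralExtension (E := E) (E' := E') ι q)
    (hσ : IsSplit q σ) (hB : IsPrincipalBundle (EX := EX) (EP := EB) (E := E) π act)
    (hB' : IsPrincipalBundle (EX := EX) (EP := EB') (E := E') π' act')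
    (hr : IsLifting (EB := EB) (EB' := EB') q π act π' act' r)
    (hcomp : IsCompatible q r θ θ') (hθ' : IsConnection act' θ') {F : DForm EB B 2 LieT}
    (hF : IsBaseCurvature r (verticalPart ι σ r θ θ') F) (K : DForm EX X 2 LieT) :
    IsCurving q act (gerbeConnection ι q σ θ) (F - pullback 𝓘(ℝ, EB) 𝓘(ℝ, EX) π K) := by
  have ha' := hB'.isSmoothAction
  have hsec := (hr.isPrincipalBundle hext hB hB').hasLocalSections.prodMap_id (E' := E') (G' := G')
  have hN := isSmoothForm_iff.1 (hθ'.verticalPart (σ := σ) hext ha' hcomp).smooth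
  have hpull := pullback_gerbeConnection hext hσ ha' hcomp hr.smooth hθ'
  have hfst : ContMDiff (𝓘(ℝ, EB).prod 𝓘(ℝ, E')) 𝓘(ℝ, EB) ∞ (gerbeFst : LiftingGerbe B G' → B) :=
    contMDiff_fst
  have hsnd : ContMDiff (𝓘(ℝ, EB).prod 𝓘(ℝ, E')) 𝓘(ℝ, EB) ∞
      (gerbeSnd q act : LiftingGerbe B G' → B) :=
    hB.smooth_act.comp (contMDiff_fst.prodMk (hext.smooth_proj.comp contMDiff_snd))
  -- Smoothness of γ ↦ Z_σ(γ⁻¹, ·) is never shown directly; smoothness of the connection is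
  -- inherited by descent from the pull-backs of `N`.
  have hA : IsSmoothForm (𝓘(ℝ, EB).prod 𝓘(ℝ, E')) (gerbeConnection ι q σ θ) := by
    refine hsec.isSmoothForm_of_pullback ?_
    rw [hpull, sub_eq_add_neg]
    exact isSmoothForm_iff.2 fun z => ((hN _).pullback ha'.smooth.contMDiffAt).add
      ((hN _).pullback contMDiffAt_fst).neg
  have hK : pullback (𝓘(ℝ, EB).prod 𝓘(ℝ, E')) 𝓘(ℝ, EB) (gerbeSnd q act : LiftingGerbe B G' → B)
      (pullback 𝓘(ℝ, EB) 𝓘(ℝ, EX) π K) =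
      pullback (𝓘(ℝ, EB).prod 𝓘(ℝ, E')) 𝓘(ℝ, EB) (gerbeFst : LiftingGerbe B G' → B)
        (pullback 𝓘(ℝ, EB) 𝓘(ℝ, EX) π K) := by
    funext z
    rw [← pullback_comp (hB.smooth_proj.mdiffAt _) (hsnd.mdiffAt z),
      ← pullback_comp (hB.smooth_proj.mdiffAt _) (hfst.mdiffAt z)]
    congr 1
    funext y
    exact hB.proj_act _ _
  rw [IsCurving, curvature_circle, pullback_sub, pullback_sub, hK, neg_sub, sub_add_sub_cancel']
  refine hsec.pullback_injective ?_
  funext z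
  rw [← dForm_pullback (isSmoothForm_iff.1 hA _) hsec.smooth.contMDiffAt, hpull,
    dForm_sub ((hN _).pullback ha'.smooth.contMDiffAt) ((hN _).pullback contMDiffAt_fst),
    dForm_pullback (hN _) ha'.smooth.contMDiffAt, dForm_pullback (hN _) contMDiffAt_fst,
    ← curvature_circle, ← hF.pullback_eq,
    ← pullback_comp (hr.smooth.mdiffAt _) (ha'.smooth.mdiffAt z),
    ← pullback_comp (hr.smooth.mdiffAt _) (contMDiff_fst.mdiffAt z), pullback_sub]
  have hsub : ∀ α β : DForm (EB' × E') (B' × G') 2 LieT, (α - β) z = α z - β z := fun _ _ => rfl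
  rw [hsub, ← pullback_comp (hsnd.mdiffAt _) (hsec.smooth.mdiffAt z),
    ← pullback_comp (hfst.mdiffAt _) (hsec.smooth.mdiffAt z)]
  congr 2
  funext y
  exact hr.equivariant _ _

/-- Both sides have the same pull-back to `B'`, where π ∘ r = π' identifies the two pull-backs of
`K`. -/
theorem curving_eq_sub (hext : IsCentralExtension (E := E) (E' := E') ι q)
    (hσ : IsSplit q σ) (hB : IsPrincipalBundle (EX := EX) (EP := EB) (E := E) π act)
    (hB' : IsPrincipalBundle (EX := EX) (EP := EB') (E := E') π' act')
    (hr : IsLifting (EB := EB) (EB' := EB') q π act π' act' r)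
    (hcomp : IsCompatible q r θ θ') (hθ : IsConnection act θ) (hθ' : IsConnection act' θ')
    (hL : IsSplitting (EB := EB) ι q act L) {F : DForm EB B 2 LieT} {K : DForm EX X 2 LieT}
    (hF : IsBaseCurvature r (verticalPart ι σ r θ θ') F) (hK : IsScalarCurvature L G' π' r θ' K) :
    curving G ι L σ θ = F - pullback 𝓘(ℝ, EB) 𝓘(ℝ, EX) π K := by
  refine (hr.isPrincipalBundle hext hB hB').hasLocalSections.pullback_injective ?_
  rw [pullback_curving hext hσ hcomp hr.smooth hL hθ.smooth hθ'.smooth, pullback_sub,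
    hF.pullback_eq, curvature_circle, ← hK.pullback_eq]
  congr 1
  funext b
  rw [← pullback_comp (hB.smooth_proj.mdiffAt _) (hr.smooth.mdiffAt b)]
  congr 1
  funext y
  exact (hr.proj y).symm

/-- Upstairs the curvature is dN, so the pull-back of dF is ddN = 0. -/
theorem dForm_isBaseCurvature {actT : B' → Circle → B'}
    (h : IsPrincipalBundle (EX := EB) (EP := EB') (E := LieT) r actT) {N : DForm EB' B' 1 LieT}
    (hN : IsSmoothForm 𝓘(ℝ, EB') N) {F : DForm EB B 2 LieT} (hF : IsBaseCurvature r N F) :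
    dForm 𝓘(ℝ, EB) F = 0 := by
  refine h.hasLocalSections.pullback_injective ?_
  funext b
  rw [← dForm_pullback (isSmoothForm_iff.1 hF.smooth _) h.smooth_proj.contMDiffAt, hF.pullback_eq,
    curvature_circle, dForm_dForm hN]
  ext v
  rfl

theorem dForm_base_sub (hB : IsPrincipalBundle (EX := EX) (EP := EB) (E := E) π act)
    {F : DForm EB B 2 LieT} {K : DForm EX X 2 LieT} (hF : IsSmoothForm 𝓘(ℝ, EB) F)
    (hdF : dForm 𝓘(ℝ, EB) F = 0) (hK : IsSmoothForm 𝓘(ℝ, EX) K) :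
    dForm 𝓘(ℝ, EB) (F - pullback 𝓘(ℝ, EB) 𝓘(ℝ, EX) π K) =
      pullback 𝓘(ℝ, EB) 𝓘(ℝ, EX) π (-dForm 𝓘(ℝ, EX) K) := by
  have hK' := isSmoothForm_iff.1 hK
  funext b
  rw [dForm_sub (isSmoothForm_iff.1 hF b) ((hK' _).pullback hB.smooth_proj.contMDiffAt), hdF,
    dForm_pullback (hK' _) hB.smooth_proj.contMDiffAt, pullback_neg]
  exact zero_sub _

end Gerbe

end LiftingProblem

theorem mainTheorem5
    -- the Lie groups `Γ` and `Γ'` and the central extension `1 → 𝕋 → Γ' → Γ → 1`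
    {EΓ : Type*} [NormedAddCommGroup EΓ] [NormedSpace ℝ EΓ] [CompleteSpace EΓ]
    {Γ : Type*} [TopologicalSpace Γ] [ChartedSpace EΓ Γ] [Group Γ] [LieGroup 𝓘(ℝ, EΓ) ∞ Γ]
    {EΓ' : Type*} [NormedAddCommGroup EΓ'] [NormedSpace ℝ EΓ'] [CompleteSpace EΓ']
    {Γ' : Type*} [TopologicalSpace Γ'] [ChartedSpace EΓ' Γ'] [Group Γ'] [LieGroup 𝓘(ℝ, EΓ') ∞ Γ']
    (ι : Circle →* Γ') (q : Γ' →* Γ)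
    (hext : LiftingProblem.IsCentralExtension (E := EΓ) (E' := EΓ') ι q)
    -- the base manifold `X` and the principal `Γ`-bundle `π : B → X`
    {EX : Type*} [NormedAddCommGroup EX] [NormedSpace ℝ EX] [CompleteSpace EX]
    {X : Type*} [TopologicalSpace X] [ChartedSpace EX X] [IsManifold 𝓘(ℝ, EX) ∞ X]
    {EB : Type*} [NormedAddCommGroup EB] [NormedSpace ℝ EB] [CompleteSpace EB]
    {B : Type*} [TopologicalSpace B] [ChartedSpace EB B] [IsManifold 𝓘(ℝ, EB) ∞ B]
    (π : B → X) (act : B → Γ → B)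
    (hB : LiftingProblem.IsPrincipalBundle (EX := EX) (EP := EB) (E := EΓ) π act)
    -- the connection `θ` and the splitting `L` of `B`
    (θ : LiftingProblem.DForm EB B 1 EΓ) (hθ : LiftingProblem.IsConnection act θ)
    (L : B → EΓ' →L[ℝ] LiftingProblem.LieT)
    (hL : LiftingProblem.IsSplitting (EB := EB) ι q act L)
    -- the lifting `(B', r)` and the compatible connection `θ'`
    {EB' : Type*} [NormedAddCommGroup EB'] [NormedSpace ℝ EB'] [CompleteSpace EB']
    {B' : Type*} [TopologicalSpace B'] [ChartedSpace EB' B'] [IsManifold 𝓘(ℝ, EB') ∞ B']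
    (π' : B' → X) (act' : B' → Γ' → B')
    (hB' : LiftingProblem.IsPrincipalBundle (EX := EX) (EP := EB') (E := EΓ') π' act')
    (r : B' → B)
    (hr : LiftingProblem.IsLifting (EB := EB) (EB' := EB') q π act π' act' r)
    (θ' : LiftingProblem.DForm EB' B' 1 EΓ') (hθ' : LiftingProblem.IsConnection act' θ')
    (hcomp : LiftingProblem.IsCompatible q r θ θ')
    -- the split `σ` of the Lie algebra
    (σ : EΓ →L[ℝ] EΓ') (hσ : LiftingProblem.IsSplit q σ) :
    -- `N = θ' - σ (r^* θ)` takes values in `iℝ` and is a connection on the `𝕋`-bundle `r : B' → B`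
    LiftingProblem.mapForm (LiftingProblem.lieMap ι)
        (LiftingProblem.verticalPart ι σ r θ θ') =
      θ' - LiftingProblem.mapForm σ (LiftingProblem.pullback 𝓘(ℝ, EB') 𝓘(ℝ, EB) r θ) ∧
    LiftingProblem.IsPrincipalBundle (EX := EB) (EP := EB') (E := LiftingProblem.LieT)
      r (fun (b : B') (u : Circle) => act' b (ι u)) ∧
    LiftingProblem.IsConnection (fun (b : B') (u : Circle) => act' b (ι u))
      (LiftingProblem.verticalPart ι σ r θ θ') ∧
    -- the curvature `F_N` and the scalar curvature `K` are well defined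
    (∃! F : LiftingProblem.DForm EB B 2 LiftingProblem.LieT,
      LiftingProblem.IsBaseCurvature r (LiftingProblem.verticalPart ι σ r θ θ') F) ∧
    (∃! K : LiftingProblem.DForm EX X 2 LiftingProblem.LieT,
      LiftingProblem.IsScalarCurvature L Γ' π' r θ' K) ∧
    -- `f = F_N - π^* K`, and the `3`-curvature is `-dK`
    ∀ (F : LiftingProblem.DForm EB B 2 LiftingProblem.LieT)
      (K : LiftingProblem.DForm EX X 2 LiftingProblem.LieT),
      LiftingProblem.IsBaseCurvature r (LiftingProblem.verticalPart ι σ r θ θ') F →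
      LiftingProblem.IsScalarCurvature L Γ' π' r θ' K →
      LiftingProblem.curving Γ ι L σ θ =
        F - LiftingProblem.pullback 𝓘(ℝ, EB) 𝓘(ℝ, EX) π K ∧
      ∀ Ξ : LiftingProblem.DForm EX X 3 LiftingProblem.LieT,
        LiftingProblem.IsThreeCurvature q π act
          (LiftingProblem.gerbeConnection ι q σ θ) (LiftingProblem.curving Γ ι L σ θ) Ξ ↔
        Ξ = -LiftingProblem.dForm 𝓘(ℝ, EX) K := by
  have hT := hr.isPrincipalBundle hext hB hB'
  have hN := hθ'.verticalPart (σ := σ) hext hB'.isSmoothAction hcomp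
  refine ⟨hcomp.mapForm_incl_verticalPart hext hσ, hT, hN, hT.existsUnique_isBaseCurvature hN,
    hr.existsUnique_isScalarCurvature hB' hL hθ', fun F K hF hK => ?_⟩
  have hf := LiftingProblem.curving_eq_sub hext hσ hB hB' hr hcomp hθ hθ' hL hF hK
  have hd := LiftingProblem.dForm_base_sub hB hF.smooth
    (LiftingProblem.dForm_isBaseCurvature hT hN.smooth hF) hK.smooth
  -- Uniqueness of Ξ is injectivity of π^*. In the other direction -dK is smooth, pulls back to df,
  -- and the curving condition holds in the form F_N - π^*K.
  refine ⟨hf, fun Ξ => ⟨fun h => hB.hasLocalSections.pullback_injective ?_, ?_⟩⟩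
  · rw [← hd, ← h.dForm_eq, hf]
  · rintro rfl
    rw [hf]
    exact ⟨LiftingProblem.isCurving_curving hext hσ hB hB' hr hcomp hθ' hF K,
      LiftingProblem.isSmoothForm_iff.2 fun x =>
        (LiftingProblem.isSmoothForm_iff.1 hK.smooth.dForm x).neg, hd⟩
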